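/- **Setting.** Let $d\ge 1$, $b_1,\dots,b_d\ge 1$, $b=\sum_i b_i$, $\tilde b=\max_i b_i$, $\mathbb T=\mathbb R/\mathbb Z$. Points of $\mathbb T^b$ (or $\mathbb R^b$) are written $x=(x^1,\dots,x^d)$ with $x^i\in\mathbb T^{b_i}$ (or $\mathbb R^{b_i}$), and $x_j^\neg$ denotes $x$ with its block $x^j$ deleted. For $k\in\mathbb Z^d$ and $\omega\in\mathbb R^b$ put $k\omega=(k_1\omega^1,\dots,k_d\omega^d)$. On $\mathbb Z^d$ and $\mathbb R^l$, $|\cdot|$ is the maximum norm, with $\mathrm{diam}$ and $\mathrm{dist}$ taken with respect to it and $\mathrm{dist}(k,\emptyset)=\infty$. Let $v:\mathbb T^b\to\mathbb R$ be real analytic, $\rho>0$, $\lambda>1$, and let $S$ be a self-adjoint Toeplitz matrix on $\ell^2(\mathbb Z^d)$ with $|S(n,n')|\le e^{-\rho|n-n'|}$. Put $$H(x)=S+\lambda v(x+n\omega)\delta_{nn'},\qquad G_\Lambda(E;x)=\bigl(R_\Lambda(\lambda^{-1}H(x)-E)R_\Lambda\bigr)^{-1}$$ for finite $\Lambda\subset\mathbb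 Z^d$ and $E\in\mathbb R$, where $R_\Lambda$ is restriction to $\Lambda$, the inverse is taken on $\ell^2(\Lambda)$, $\|\cdot\|$ is the $\ell^2$ operator norm, and $\|G_\Lambda(E;x)\|=\infty$ if the restricted operator is not invertible. **Elementary regions.** For real $N>0$, $\mathcal E_N^0$ consists of the cube $[-N,N]^d\cap\mathbb Z^d$ and of all sets $([-N,N]^d\cap\mathbb Z^d)\setminus\{n: n_i\,\varsigma_i\,0,\ 1\le i\le d\}$ with $\varsigma_i\in\{<,>,\emptyset\}$, at least two of them different from $\emptyset$ (where $\emptyset$ imposes no condition). $\mathcal E_N$ is the set of all translates, by vectors of $\mathbb Z^d$, of members of $\mathcal E_N^0$. **Property P.** $(E,x)$ is $(\bar\rho,N)$ good if for every $Q\in\mathcal E^0_N$: $\|G_Q(E;x)\|\le e^{\sqrt N}$ and $|G_Q(E;x)(n,n')|\le e^{-\bar\rho|n-n'|}$ whenever $n,n'\in Q$ and $|n-n'|\ge N/10$. The Green's functions satisfy property P with parameters $(\gamma,\bar\rho)$ at size $N$, with sets $\Omega_N\subset[0,1]^b$ and $X_N=X_N(\omega,E)\subset\mathbb T^b$ ($\omega\in\Omega_N$,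 $E\in\mathbb R$), if $\Omega_N$ is a closed semi-algebraic set of degree at most $N^{4d}$ and, for all $\omega\in\Omega_N$ and $E\in\mathbb R$, $$\sup_{1\le j\le d,\ x_j^\neg\in\mathbb T^{b-b_j}}\mathrm{mes}\{\theta\in\mathbb T^{b_j}:(\theta,x_j^\neg)\in X_N\}\le e^{-N^\gamma},$$ and $(E,x)$ is $(\bar\rho,N)$ good for every $x\notin X_N$. (A closed semi-algebraic set has degree at most $D$ if it is a finite union of finite intersections of sets $\{P_\ell\,\varsigma\,0\}$, $\varsigma\in\{\ge,\le,=\}$, built from $s$ real polynomials of degree at most $t$ with $st\le D$.) **Theorem.** Let $0<c_3<c_4<1$, $c_1=\frac{c_3}{4\tilde b}$, $c_2=c_1^2/2$, and let $\rho_0>0$. There is a constant $N_*\ge1$, depending only on $d$, $(b_i)$, $c_3$, $c_4$, $\rho$, $\rho_0$ and $v$, such that the following holds for all real $N_1\ge N_*$, with $N_2=N_1^{2/c_1}$ and $N_3=e^{N_2^{c_2}}$, for all $S$ and $\lambda$ as above and all $\bar\rho\ge\rho_0$. Suppose that the Green's functions satisfy property P with parameters $(c_1,\bar\rho)$ at size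 $N_1$, with sets $\Omega_{N_1},X_{N_1}$, and at size $N_2$, with sets $\Omega_{N_2},X_{N_2}$. Let $\omega\in\Omega_{N_2}\cap\Omega_{N_1}$, $E\in\mathbb R$ and $x\in\mathbb R^b$. Let $N\in[\frac14N_3^{c_3},N_3^{c_4}]$ be real and let $\bar\Lambda\subset\Lambda\in\mathcal E_N$ with $\mathrm{diam}(\bar\Lambda)\le 10N^{\frac1{10d}}$ be such that for every $k\in\Lambda\setminus\bar\Lambda$: - there is $W\in\mathcal E_{N_1}$ with $k\in W\subset\Lambda\setminus\bar\Lambda$ and $\mathrm{dist}\bigl(k,(\Lambda\setminus\bar\Lambda)\setminus W\bigr)\ge\frac{N_1}2$, and - $x+k\omega \bmod \mathbb Z^b\notin X_{N_1}(\omega,E)$. Then for every $1\le j\le d$ the set $$Y=\{y\in\mathbb R^{b_j}: |y-x^j|\le e^{-\rho N_1},\ \|G_\Lambda(E;(y,x_j^\neg))\|\ge e^{\sqrt N}\}$$ satisfies $$\mathrm{mes}(Y)\le e^{-N^{1/(3b_j)}}.$$ -/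

import Mathlib

open scoped ENNReal
open MeasureTheory

namespace QPGreen

/-- Real vectors `x = (x^1, …, x^d)` with blocks `x^i ∈ ℝ^{b_i}`. -/
abbrev Vec {d : ℕ} (b : Fin d → ℕ) : Type := (i : Fin d) → Fin (b i) → ℝ

/-- The torus `𝕋^b = ∏ i, 𝕋^{b_i}`, where `𝕋 = ℝ / ℤ`. -/
abbrev Torus {d : ℕ} (b : Fin d → ℕ) : Type := (i : Fin d) → Fin (b i) → UnitAddCircle

/-- Reduction modulo `ℤ^b`. -/
def toTorus {d : ℕ} {b : Fin d → ℕ} (x : Vec b) : Torus b := fun i l => (x i l : UnitAddCircle)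

/-- `x + k ω mod ℤ^b`, where `k ω = (k_1 ω^1, …, k_d ω^d)`. -/
def shift {d : ℕ} {b : Fin d → ℕ} (x : Torus b) (ω : Vec b) (k : Fin d → ℤ) : Torus b :=
  x + toTorus (fun i => (k i : ℝ) • ω i)

/-- `v` is real analytic on `𝕋^b`: its `ℤ^b`-periodic lift to `ℝ^b` is real analytic. -/
def IsAnalyticOnTorus {d : ℕ} {b : Fin d → ℕ} (v : Torus b → ℝ) : Prop :=
  ∀ x : Vec b, AnalyticAt ℝ (fun z : Vec b => v (toTorus z)) x

/-! ### The operator and its Green's functions -/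

/-- `S` is a self-adjoint Toeplitz matrix on `ℤ^d` with `|S(n,n')| ≤ e^{-ρ|n-n'|}`
(the norm of `Fin d → ℤ` is the maximum norm). -/
structure IsHopping {d : ℕ} (ρ : ℝ) (S : Matrix (Fin d → ℤ) (Fin d → ℤ) ℂ) : Prop where
  toeplitz : ∀ n n' k, S (n + k) (n' + k) = S n n'
  selfAdjoint : S.IsHermitian
  decay : ∀ n n', ‖S n n'‖ ≤ Real.exp (-ρ * ‖n - n'‖)

/-- The matrix of `H(x) = S + lam v(x + n ω) δ_{n n'}`. -/
noncomputable def hamiltonian {d : ℕ} {b : Fin d → ℕ} (S : Matrix (Fin d → ℤ) (Fin d → ℤ) ℂ)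
    (v : Torus b → ℝ) (lam : ℝ) (ω : Vec b) (x : Torus b) :
    Matrix (Fin d → ℤ) (Fin d → ℤ) ℂ :=
  S + Matrix.diagonal (fun n => ((lam * v (shift x ω n) : ℝ) : ℂ))

/-- The matrix of `R_Λ (lam⁻¹ H(x) - E) R_Λ` on `ℓ²(Λ)`, for a finite `Λ ⊂ ℤ^d`. -/
noncomputable def boxOperator {d : ℕ} {b : Fin d → ℕ} (S : Matrix (Fin d → ℤ) (Fin d → ℤ) ℂ)
    (v : Torus b → ℝ) (lam : ℝ) (ω : Vec b) (Λ : Finset (Fin d → ℤ)) (E : ℝ) (x : Torus b) :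
    Matrix Λ Λ ℂ :=
  ((lam : ℂ)⁻¹ • hamiltonian S v lam ω x - (E : ℂ) • 1).submatrix (fun n => n.1) (fun n => n.1)

/-- The Green's function `G_Λ(E; x)`. It is meaningful only where the restricted operator is
invertible, that is, where `greenNorm` is finite. -/
noncomputable def green {d : ℕ} {b : Fin d → ℕ} (S : Matrix (Fin d → ℤ) (Fin d → ℤ) ℂ)
    (v : Torus b → ℝ) (lam : ℝ) (ω : Vec b) (Λ : Finset (Fin d → ℤ)) (E : ℝ) (x : Torus b) :
    Matrix Λ Λ ℂ :=
  (boxOperator S v lam ω Λ E x)⁻¹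

open Classical in
/-- The `ℓ²` operator norm `‖G_Λ(E; x)‖`, equal to `∞` if the restricted operator is singular. -/
noncomputable def greenNorm {d : ℕ} {b : Fin d → ℕ} (S : Matrix (Fin d → ℤ) (Fin d → ℤ) ℂ)
    (v : Torus b → ℝ) (lam : ℝ) (ω : Vec b) (Λ : Finset (Fin d → ℤ)) (E : ℝ) (x : Torus b) :
    ℝ≥0∞ :=
  if IsUnit (boxOperator S v lam ω Λ E x) then
    ENNReal.ofReal ‖Matrix.toEuclideanCLM (n := Λ) (𝕜 := ℂ) (green S v lam ω Λ E x)‖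
  else ∞

/-! ### Elementary regions -/

/-- The lattice points of the cube `[-N, N]^d`. -/
noncomputable def cube (d : ℕ) (N : ℝ) : Finset (Fin d → ℤ) :=
  Finset.Icc (fun _ => -⌊N⌋) (fun _ => ⌊N⌋)

/-- The cube `[-N, N]^d` without the points `n` with `n_i ς_i 0` for all `i`; here `ς i = 1` stands
for `>`, `ς i = -1` for `<`, and `ς i = 0` for no condition on `n_i`. -/
noncomputable def notchedCube {d : ℕ} (N : ℝ) (ς : Fin d → SignType) : Finset (Fin d → ℤ) :=
  (cube d N).filter (fun n => ¬ ∀ i, ς i ≠ 0 → SignType.sign (n i) = ς i)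

/-- `Q` is an elementary region of size `N` centered at `0`. -/
def IsElementaryZero {d : ℕ} (N : ℝ) (Q : Finset (Fin d → ℤ)) : Prop :=
  Q = cube d N ∨
    ∃ ς : Fin d → SignType, (∃ i i', i ≠ i' ∧ ς i ≠ 0 ∧ ς i' ≠ 0) ∧ Q = notchedCube N ς

/-- `Λ` is a translate of an elementary region of size `N`. -/
def IsElementary {d : ℕ} (N : ℝ) (Λ : Finset (Fin d → ℤ)) : Prop :=
  ∃ (n : Fin d → ℤ) (Q : Finset (Fin d → ℤ)), IsElementaryZero N Q ∧
    Λ = Q.image (fun m => n + m)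

/-! ### Semi-algebraic sets -/

/-- The relations `≥`, `≤`, `=` allowed in the description of a semi-algebraic set. -/
inductive Cmp : Type
  | ge
  | le
  | eq

/-- The relation `t ς 0`. -/
def Cmp.Holds : Cmp → ℝ → Prop
  | .ge, t => 0 ≤ t
  | .le, t => t ≤ 0
  | .eq, t => t = 0

/-- `A` is a (closed) semi-algebraic set with `deg A ≤ D`: it is a finite union of finite
intersections of sets `{P_l ς 0}` built from `s` polynomials of degree at most `t`,
where `s t ≤ D`. -/
def IsSemialgebraicOfDegreeLE {σ : Type*} (A : Set (σ → ℝ)) (D : ℝ) : Prop :=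
  ∃ (s t r : ℕ) (P : Fin s → MvPolynomial σ ℝ) (L : Fin r → Finset (Fin s))
    (ς : Fin r → Fin s → Cmp),
    (∀ l, (P l).totalDegree ≤ t) ∧ ((s * t : ℕ) : ℝ) ≤ D ∧
    A = ⋃ j, ⋂ l ∈ L j, {z | (ς j l).Holds (MvPolynomial.eval z (P l))}

/-! ### Good phases and property P -/

/-- `(E, x)` is `(ρbar, N)` good. -/
def IsGood {d : ℕ} {b : Fin d → ℕ} (S : Matrix (Fin d → ℤ) (Fin d → ℤ) ℂ)
    (v : Torus b → ℝ) (lam : ℝ) (ω : Vec b) (ρbar N E : ℝ) (x : Torus b) : Prop :=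
  ∀ Q : Finset (Fin d → ℤ), IsElementaryZero N Q →
    greenNorm S v lam ω Q E x ≤ ENNReal.ofReal (Real.exp (Real.sqrt N)) ∧
    ∀ n n' : Q, N / 10 ≤ ‖n.1 - n'.1‖ →
      ‖green S v lam ω Q E x n n'‖ ≤ Real.exp (-ρbar * ‖n.1 - n'.1‖)

/-- The Green's functions satisfy property P with parameters `(γ, ρbar)` at size `N`, with the
semi-algebraic set of frequencies `Ω` (as a subset of the unit cube `[0,1]^b`) and the exceptional
sets of phases `X ω E ⊂ 𝕋^b`. The section of `X` at `x_j^¬` is the set of `θ ∈ 𝕋^{b_j}` for which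
`x`, with its block `x^j` replaced by `θ`, lies in `X`. -/
structure HasPropertyP {d : ℕ} {b : Fin d → ℕ} (S : Matrix (Fin d → ℤ) (Fin d → ℤ) ℂ)
    (v : Torus b → ℝ) (lam γ ρbar N : ℝ) (Ω : Set (Vec b))
    (X : Vec b → ℝ → Set (Torus b)) : Prop where
  subset_unit : ∀ ω ∈ Ω, ∀ i l, ω i l ∈ Set.Icc (0 : ℝ) 1
  semialgebraic : IsSemialgebraicOfDegreeLE
    {z : (Σ i : Fin d, Fin (b i)) → ℝ | (fun i l => z ⟨i, l⟩) ∈ Ω} (N ^ (4 * d))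
  measure_section_le : ∀ ω ∈ Ω, ∀ (E : ℝ) (j : Fin d) (x : Torus b),
    volume {θ : Fin (b j) → UnitAddCircle | Function.update x j θ ∈ X ω E} ≤
      ENNReal.ofReal (Real.exp (-N ^ γ))
  good : ∀ ω ∈ Ω, ∀ (E : ℝ) (x : Torus b), x ∉ X ω E → IsGood S v lam ω ρbar N E x

end QPGreen

namespace QPGreen

/-! The proof is a matrix-valued Cartan estimate. The uncontrolled sites form the set `Λbar` (called
`V` below), which has at most `21^d N^{1/10}` points. Let f be the determinant of the operator on
`Λ` divided by the one on `Λ \ V`, that is, the determinant of the Schur complement on `V`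
(`reducedDet`). By Cramer's rule a Green's function on `Λ` of norm at least `e^{√N}` forces f to be
tiny (`norm_reducedDet_bounds`), so it suffices that f is rarely tiny.

Scale `N₁` gives holomorphy and an upper bound. Good `N₁`-regions cover `Λ \ V` at the phase x; rows
of their Green's functions, pasted together, form an approximate left inverse (`isUnit_of_cover`).
The resulting bound, about `L e^{√N₁}` with `L ≥ |Λ|`, survives complex perturbations of the phase
of order `e^{-ρN₁}`. There f is holomorphic along lines and, with `q = e^{N₂}`, at most
`(2q^6)^{|V|}`.

Scale `N₂` gives a lower bound at one point. Since `N₂^{c₁} = N₁²`, the bad phases of all sites of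
`Λ` together have less measure than the ball of radius `e^{-ρN₁}`. At some `y₀` in this ball every
site is good, elementary `N₂`-regions cover all of `Λ` (`IsElementary.exists_subregion`), and
pasting again bounds the Green's function on `Λ`. Hence `|f(y₀)| ≥ q^{-2|V|}`.

A Remez–Cartan inequality (`norm_zero_le_of_small_on`) on each line through `y₀`, integrated in
polar coordinates (`volume_le_of_rays`), finishes the argument. Both bounds on f have logarithm of
order `|V| N₂`, so about `N^{1/8}` interpolation nodes suffice; a node spacing `h = e^{-N^{3/8}}`
costs at most a factor with logarithm `N^{1/8} N^{3/8} = √N`, which the smallness of f pays for. The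
bad set has measure of order `N^{1/8} h ≤ e^{-N^{1/3}}`, up to a dimensional constant; slicing by
rays keeps the exponent independent of `b j`.

The scales fit because `log N₃ = N₂^{c₂} = N₁^{c₁}`: powers of `|Λ|` are subexponential in `N₁`,
while `N₂` is only a power of `log N`. -/

/-! ### A Remez–Cartan inequality for holomorphic functions of one variable -/

/-- Maximum principle on a disc. -/
theorem norm_le_of_sphere_bound {f : ℂ → ℂ} {U : Set ℂ} {R K : ℝ} (hR0 : 0 < R)
    (hR : Metric.closedBall 0 R ⊆ U) (hf : DifferentiableOn ℂ f U)
    (hK : ∀ z, ‖z‖ = R → ‖f z‖ ≤ K) {z : ℂ} (hz : ‖z‖ ≤ R) : ‖f z‖ ≤ K := by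
  have hcl : closure (Metric.ball (0 : ℂ) R) = Metric.closedBall 0 R := closure_ball 0 hR0.ne'
  refine Complex.norm_le_of_forall_mem_frontier_norm_le (U := Metric.ball (0 : ℂ) R)
    Metric.isBounded_ball ?_ ?_ ?_
  · refine DifferentiableOn.diffContOnCl ?_
    rw [hcl]
    exact hf.mono hR
  · intro w hw
    rw [frontier_ball 0 hR0.ne'] at hw
    exact hK w (by simpa using hw)
  · rw [hcl]
    simpa using hz

/-- A Schwarz lemma for holomorphic functions with many zeros. -/
theorem norm_le_of_zeros {U : Set ℂ} (hU : IsOpen U) {R a : ℝ} (ha : 0 ≤ a) (haR : a < R)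
    (hR : Metric.closedBall 0 R ⊆ U) (s : Finset ℂ) (hs : ∀ z ∈ s, ‖z‖ ≤ a) :
    ∀ (f : ℂ → ℂ) (K : ℝ), DifferentiableOn ℂ f U → (∀ z ∈ s, f z = 0) →
      (∀ z, ‖z‖ = R → ‖f z‖ ≤ K) →
      ∀ z, ‖z‖ ≤ a → ‖f z‖ ≤ K * (2 * a / (R - a)) ^ s.card := by
  induction s using Finset.induction_on with
  | empty =>
    intro f K hf _ hK z hz
    simpa using norm_le_of_sphere_bound (ha.trans_lt haR) hR hf hK (hz.trans haR.le)
  | insert p s hp ih =>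
    intro f K hf h0 hK z hz
    have hpa : ‖p‖ ≤ a := hs p (Finset.mem_insert_self _ _)
    have hpU : p ∈ U := hR (by simpa using hpa.trans haR.le)
    have hfac : ∀ w, f w = (w - p) * dslope f p w := by
      intro w
      have := sub_smul_dslope f p w
      rw [h0 p (Finset.mem_insert_self _ _), sub_zero] at this
      simpa using this.symm
    have hRa : 0 < R - a := sub_pos.2 haR
    -- Dividing out one zero by `dslope` costs `1 / (R - a)` on the outer circle and returns at most
    -- `2a` on the inner disc. The induction must range over `f` and `K`, since both change.
    have key := ih (fun w hw => hs w (Finset.mem_insert_of_mem hw)) (dslope f p) (K / (R - a))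
      ((Complex.differentiableOn_dslope (hU.mem_nhds hpU)).2 hf)
      (by
        intro w hw
        have h1 := hfac w
        rw [h0 w (Finset.mem_insert_of_mem hw)] at h1
        have hne : w - p ≠ 0 := sub_ne_zero.2 (fun h => hp (h ▸ hw))
        exact (mul_eq_zero.1 h1.symm).resolve_left hne)
      (by
        intro w hw
        have h1 := hK w hw
        rw [hfac w, norm_mul] at h1
        have h2 : R - a ≤ ‖w - p‖ := by
          have := norm_sub_norm_le w p
          linarith
        rw [le_div_iff₀ hRa]
        nlinarith [norm_nonneg (dslope f p w)])
      z hz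
    rw [hfac z, norm_mul, Finset.card_insert_of_notMem hp, pow_succ]
    have h2 : ‖z - p‖ ≤ 2 * a := by
      have := norm_sub_le z p
      linarith
    calc ‖z - p‖ * ‖dslope f p z‖
        ≤ (2 * a) * (K / (R - a) * (2 * a / (R - a)) ^ s.card) := by gcongr
      _ = _ := by ring

/-- A subset of the line whose measure exceeds `2 n h` contains `n + 1` points which are
`h`-separated. -/
theorem exists_separated {F : Set ℝ} {h : ℝ} (hh : 0 < h) (n : ℕ)
    (hF : ENNReal.ofReal (2 * n * h) < volume F) :
    ∃ s : Finset ℝ, ↑s ⊆ F ∧ s.card = n + 1 ∧ ∀ x ∈ s, ∀ y ∈ s, x ≠ y → h ≤ |x - y| := by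
  have main : ∀ k : ℕ, k ≤ n + 1 → ∃ s : Finset ℝ, ↑s ⊆ F ∧ s.card = k ∧
      ∀ x ∈ s, ∀ y ∈ s, x ≠ y → h ≤ |x - y| := by
    intro k
    induction k with
    | zero => intro _; exact ⟨∅, by simp⟩
    | succ k ih =>
      intro hk
      obtain ⟨s, hsF, hsc, hsep⟩ := ih (by omega)
      -- Greedy choice: the `h`-balls around at most `n` chosen points have total length at most
      -- `2nh`, so they leave part of `F` uncovered.
      have hvol : volume (⋃ p ∈ s, Metric.ball p h) < volume F := by
        refine lt_of_le_of_lt (measure_biUnion_finset_le s _) (lt_of_le_of_lt ?_ hF)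
        simp only [Real.volume_ball, Finset.sum_const, hsc]
        rw [nsmul_eq_mul, ← ENNReal.ofReal_natCast, ← ENNReal.ofReal_mul (by positivity)]
        apply ENNReal.ofReal_le_ofReal
        have : (k : ℝ) ≤ n := by exact_mod_cast (by omega : k ≤ n)
        nlinarith
      have hnot : ¬ F ⊆ ⋃ p ∈ s, Metric.ball p h := fun hsub =>
        absurd (measure_mono hsub) (not_le.2 hvol)
      obtain ⟨q, hqF, hq⟩ := Set.not_subset.1 hnot
      have hq' : ∀ p ∈ s, h ≤ |q - p| := by
        intro p hp
        by_contra hlt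
        push Not at hlt
        exact hq (Set.mem_iUnion₂.2 ⟨p, hp, by simpa [Real.dist_eq] using hlt⟩)
      have hqs : q ∉ s := fun hqs => by
        have := hq' q hqs
        simp at this
        linarith
      refine ⟨insert q s, ?_, by rw [Finset.card_insert_of_notMem hqs, hsc], ?_⟩
      · intro x hx
        rcases Finset.mem_insert.1 (Finset.mem_coe.1 hx) with rfl | hx
        · exact hqF
        · exact hsF hx
      · intro x hx y hy hxy
        rcases Finset.mem_insert.1 hx with hx | hx <;> rcases Finset.mem_insert.1 hy with hy | hy
        · exact absurd (hx.trans hy.symm) hxy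
        · rw [hx]; exact hq' y hy
        · rw [hy, abs_sub_comm]; exact hq' x hx
        · exact hsep x hx y hy hxy
  exact main (n + 1) le_rfl

/-- Growth of Lagrange interpolation with separated nodes. -/
theorem norm_eval_interpolate_le {s : Finset ℂ} {R h ε : ℝ} (hh : 0 < h)
    (hs : ∀ z ∈ s, ‖z‖ ≤ R) (hsep : ∀ z ∈ s, ∀ w ∈ s, z ≠ w → h ≤ ‖z - w‖) (f : ℂ → ℂ)
    (hf : ∀ z ∈ s, ‖f z‖ ≤ ε) {z : ℂ} (hz : ‖z‖ ≤ R) :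
    ‖(Lagrange.interpolate s id f).eval z‖ ≤ s.card * (ε * (2 * R / h) ^ (s.card - 1)) := by
  rw [Lagrange.interpolate_apply, Polynomial.eval_finsetSum]
  refine (norm_sum_le _ _).trans ?_
  rw [← nsmul_eq_mul]
  refine Finset.sum_le_card_nsmul _ _ _ (fun i hi => ?_)
  rw [Polynomial.eval_mul, Polynomial.eval_C, norm_mul]
  refine mul_le_mul (hf i hi) ?_ (norm_nonneg _) ((norm_nonneg _).trans (hf i hi))
  rw [Lagrange.basis, Polynomial.eval_prod, norm_prod]
  calc ∏ j ∈ s.erase i, ‖(Lagrange.basisDivisor (id i) (id j)).eval z‖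
      ≤ ∏ _j ∈ s.erase i, (2 * R / h) := by
        refine Finset.prod_le_prod (fun _ _ => norm_nonneg _) (fun j hj => ?_)
        have hj' := Finset.mem_erase.1 hj
        simp only [Lagrange.basisDivisor, id, Polynomial.eval_mul, Polynomial.eval_C,
          Polynomial.eval_sub, Polynomial.eval_X, norm_mul, norm_inv]
        have h1 := hsep i hi j hj'.2 hj'.1.symm
        have h2 : ‖z - j‖ ≤ 2 * R := by
          have := norm_sub_le z j
          have := hs j hj'.2
          linarith
        rw [div_eq_inv_mul]
        gcongr
    _ = _ := by rw [Finset.prod_const, Finset.card_erase_of_mem hi]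

/-- If a holomorphic function bounded by `B` on the disc of radius `9 a` is at most `ε` on a set of
points of `[-a, a]` of measure more than `2 n h`, then it is small at the origin. -/
theorem norm_zero_le_of_small_on {f : ℂ → ℂ} {U : Set ℂ} (hU : IsOpen U) {a B ε h : ℝ}
    (ha : 0 < a) (hR : Metric.closedBall 0 (9 * a) ⊆ U) (hf : DifferentiableOn ℂ f U)
    (hB : ∀ z, ‖z‖ = 9 * a → ‖f z‖ ≤ B) (hh : 0 < h) (n : ℕ) {F : Set ℝ}
    (hFa : ∀ t ∈ F, |t| ≤ a) (hF : ∀ t ∈ F, ‖f t‖ ≤ ε)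
    (hvol : ENNReal.ofReal (2 * n * h) < volume F) :
    ‖f 0‖ ≤ B * (1 / 4) ^ (n + 1) + 2 * ((n + 1) * (ε * (18 * a / h) ^ n)) := by
  obtain ⟨s', hs'F, hs'c, hs'sep⟩ := exists_separated hh n hvol
  set s : Finset ℂ := s'.map ⟨Complex.ofReal, Complex.ofReal_injective⟩ with hsdef
  have hsc : s.card = n + 1 := by rw [hsdef, Finset.card_map, hs'c]
  have hmem : ∀ z ∈ s, ∃ t ∈ s', (t : ℂ) = z := by
    intro z hz
    simpa [hsdef] using hz
  have hsa : ∀ z ∈ s, ‖z‖ ≤ a := by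
    intro z hz
    obtain ⟨t, ht, rfl⟩ := hmem z hz
    simpa using hFa t (hs'F ht)
  have hfs : ∀ z ∈ s, ‖f z‖ ≤ ε := by
    intro z hz
    obtain ⟨t, ht, rfl⟩ := hmem z hz
    exact hF t (hs'F ht)
  have hsep : ∀ z ∈ s, ∀ w ∈ s, z ≠ w → h ≤ ‖z - w‖ := by
    intro z hz w hw hzw
    obtain ⟨t, ht, rfl⟩ := hmem z hz
    obtain ⟨t', ht', rfl⟩ := hmem w hw
    rw [← Complex.ofReal_sub, Complex.norm_real]
    exact hs'sep t ht t' ht' (fun e => hzw (by rw [e]))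
  set L := Lagrange.interpolate s id f with hL
  have hLb : ∀ z : ℂ, ‖z‖ ≤ 9 * a → ‖L.eval z‖ ≤ (n + 1) * (ε * (18 * a / h) ^ n) := by
    intro z hz
    have := norm_eval_interpolate_le hh (R := 9 * a) (fun w hw => (hsa w hw).trans (by linarith))
      hsep f hfs hz
    rw [hsc] at this
    rw [show 18 * a = 2 * (9 * a) by ring]
    rwa [Nat.add_sub_cancel, Nat.cast_add, Nat.cast_one] at this
  have h0 : ‖(0 : ℂ)‖ ≤ 9 * a := by simp; positivity
  -- The interpolant is small on the whole disc, and the remainder has `n + 1` zeros, so the Schwarz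
  -- lemma makes it small at the origin.
  have hdiff : DifferentiableOn ℂ (fun z => f z - L.eval z) U :=
    hf.sub L.differentiable.differentiableOn
  have key := norm_le_of_zeros hU ha.le (by linarith : a < 9 * a) hR s hsa
    (fun z => f z - L.eval z) (B + (n + 1) * (ε * (18 * a / h) ^ n)) hdiff
    (by
      intro z hz
      have := Lagrange.eval_interpolate_at_node (s := s) (v := (id : ℂ → ℂ)) f
        (Set.injOn_id _) hz
      rw [id] at this
      rw [hL, this, sub_self])
    (by
      intro z hz
      exact (norm_sub_le _ _).trans (add_le_add (hB z hz) (hLb z hz.le)))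
    0 (by simpa using ha.le)
  -- The outer radius `9a` makes each zero gain `1/4`, which is below `e⁻¹`; `cartan_numerics`
  -- relies on this.
  rw [hsc, show 2 * a / (9 * a - a) = 1 / 4 by field_simp; norm_num] at key
  have h1 := hLb 0 h0
  have h2 : ‖f 0‖ ≤ ‖f 0 - L.eval 0‖ + ‖L.eval 0‖ := by
    simpa using norm_add_le (f 0 - L.eval 0) (L.eval 0)
  have hX : 0 ≤ (n + 1) * (ε * (18 * a / h) ^ n) := (norm_nonneg _).trans h1
  have hq : ((1 : ℝ) / 4) ^ (n + 1) ≤ 1 := pow_le_one₀ (by norm_num) (by norm_num)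
  nlinarith

/-! ### Matrices with controlled inverses -/

section LinftyNorm

open scoped Matrix.Norms.Operator

/-- The scoped norm is the maximal row sum. It is submultiplicative, so Neumann series apply, and it
is read off directly from entrywise decay. -/
theorem linfty_norm_le_iff {m : Type*} [Fintype m] {A : Matrix m m ℂ} {p : ℝ} (hp : 0 ≤ p) :
    ‖A‖ ≤ p ↔ ∀ i, ∑ j, ‖A i j‖ ≤ p := by
  lift p to NNReal using hp
  rw [Matrix.linfty_opNorm_def, NNReal.coe_le_coe, Finset.sup_le_iff]
  simp only [Finset.mem_univ, true_imp_iff, ← NNReal.coe_le_coe, NNReal.coe_sum, coe_nnnorm]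

/-- A matrix with an approximate left inverse is invertible. -/
theorem isUnit_of_approx_inverse {m : Type*} [Fintype m] [DecidableEq m] {A P K : Matrix m m ℂ}
    {p : ℝ} (hp : 0 ≤ p) (h : P * A = 1 + K) (hK : ∀ i, ∑ j, ‖K i j‖ ≤ 1 / 2)
    (hP : ∀ i, ∑ j, ‖P i j‖ ≤ p) :
    IsUnit A ∧ ∀ i, ∑ j, ‖A⁻¹ i j‖ ≤ 2 * p := by
  have hK' : ‖K‖ ≤ 1 / 2 := (linfty_norm_le_iff (by norm_num)).2 hK
  have hP' : ‖P‖ ≤ p := (linfty_norm_le_iff hp).2 hP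
  have h1 : IsUnit (1 + K) := by
    have := isUnit_one_sub_of_norm_lt_one (x := -K) (by rw [norm_neg]; linarith)
    rwa [sub_neg_eq_add] at this
  have hA : IsUnit A := by
    -- For square matrices a one-sided approximate inverse suffices: the determinant of `P * A` is a
    -- unit, hence so is that of `A`.
    rw [← h, Matrix.isUnit_iff_isUnit_det, Matrix.det_mul] at h1
    rw [Matrix.isUnit_iff_isUnit_det]
    exact isUnit_of_mul_isUnit_right h1
  refine ⟨hA, (linfty_norm_le_iff (by positivity)).1 ?_⟩
  have hAA : A * A⁻¹ = 1 := Matrix.mul_nonsing_inv _ ((Matrix.isUnit_iff_isUnit_det A).1 hA)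
  have h2 : A⁻¹ = P - K * A⁻¹ := by
    have h3 : P * A * A⁻¹ = (1 + K) * A⁻¹ := by rw [h]
    rw [Matrix.mul_assoc, hAA, Matrix.mul_one, Matrix.add_mul, Matrix.one_mul] at h3
    rw [h3]
    abel
  have h4 : ‖A⁻¹‖ ≤ ‖P‖ + ‖K‖ * ‖A⁻¹‖ := by
    calc ‖A⁻¹‖ = ‖P - K * A⁻¹‖ := by rw [← h2]
      _ ≤ ‖P‖ + ‖K * A⁻¹‖ := norm_sub_le _ _
      _ ≤ ‖P‖ + ‖K‖ * ‖A⁻¹‖ := by gcongr; exact norm_mul_le _ _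
  nlinarith [norm_nonneg A⁻¹]

end LinftyNorm

/-- Stability of the inverse under small diagonal perturbations. -/
theorem isUnit_add_diagonal {m : Type*} [Fintype m] [DecidableEq m] {A : Matrix m m ℂ}
    (hA : IsUnit A) {p κ : ℝ} (hp : 0 ≤ p) (hAi : ∀ i, ∑ j, ‖A⁻¹ i j‖ ≤ p) {w : m → ℂ}
    (hw : ∀ i, ‖w i‖ ≤ κ) (hpκ : p * κ ≤ 1 / 2) :
    IsUnit (A + Matrix.diagonal w) ∧ ∀ i, ∑ j, ‖(A + Matrix.diagonal w)⁻¹ i j‖ ≤ 2 * p := by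
  refine isUnit_of_approx_inverse (P := A⁻¹) (K := A⁻¹ * Matrix.diagonal w) hp ?_ ?_ hAi
  · rw [Matrix.mul_add, Matrix.nonsing_inv_mul _ ((Matrix.isUnit_iff_isUnit_det A).1 hA)]
  · intro i
    have hκ : 0 ≤ κ := (norm_nonneg _).trans (hw i)
    calc ∑ j, ‖(A⁻¹ * Matrix.diagonal w) i j‖ ≤ ∑ j, ‖A⁻¹ i j‖ * κ := by
          refine Finset.sum_le_sum (fun j _ => ?_)
          rw [Matrix.mul_diagonal, norm_mul]
          gcongr
          exact hw j
      _ = (∑ j, ‖A⁻¹ i j‖) * κ := by rw [Finset.sum_mul]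
      _ ≤ p * κ := by gcongr; exact hAi i
      _ ≤ 1 / 2 := hpκ

theorem norm_entry_le_toEuclideanCLM {m : Type*} [Fintype m] [DecidableEq m] (G : Matrix m m ℂ)
    (i j : m) : ‖G i j‖ ≤ ‖Matrix.toEuclideanCLM (n := m) (𝕜 := ℂ) G‖ := by
  have h1 : (Matrix.toEuclideanCLM (n := m) (𝕜 := ℂ) G (EuclideanSpace.single j 1)) i = G i j := by
    rw [Matrix.ofLp_toEuclideanCLM]
    simp
  rw [← h1]
  refine (PiLp.norm_apply_le _ i).trans ?_
  simpa using (Matrix.toEuclideanCLM (n := m) (𝕜 := ℂ) G).le_opNorm (EuclideanSpace.single j 1)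

/-- Crude comparison of `ℓ²` with `ℓ¹`. The factor `card²` is harmless, since cardinalities are
absorbed in powers of `q`, or of `L` in the large-energy case. -/
theorem toEuclideanCLM_norm_le {m : Type*} [Fintype m] [DecidableEq m] {G : Matrix m m ℂ} {g : ℝ}
    (hg0 : 0 ≤ g) (hg : ∀ i j, ‖G i j‖ ≤ g) :
    ‖Matrix.toEuclideanCLM (n := m) (𝕜 := ℂ) G‖ ≤ (Fintype.card m : ℝ) ^ 2 * g := by
  refine ContinuousLinearMap.opNorm_le_bound _ (by positivity) (fun x => ?_)
  have hxj : ∀ j, ‖x j‖ ≤ ‖x‖ := fun j => PiLp.norm_apply_le _ j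
  have hy : ∀ y : EuclideanSpace ℂ m, ‖y‖ ≤ ∑ i, ‖y i‖ := by
    intro y
    calc ‖y‖ = ‖∑ i, EuclideanSpace.single i (y i)‖ := by
          congr 1
          ext k
          simp [Finset.sum_apply, Pi.single_apply]
      _ ≤ ∑ i, ‖EuclideanSpace.single i (y i)‖ := norm_sum_le _ _
      _ = ∑ i, ‖y i‖ := by simp
  refine (hy _).trans ?_
  have hrow : ∀ i, ‖(Matrix.toEuclideanCLM (n := m) (𝕜 := ℂ) G x) i‖ ≤
      Fintype.card m * (g * ‖x‖) := by
    intro i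
    rw [Matrix.ofLp_toEuclideanCLM]
    refine (norm_sum_le _ _).trans ?_
    rw [← nsmul_eq_mul, ← Finset.card_univ]
    refine Finset.sum_le_card_nsmul _ _ _ (fun j _ => ?_)
    rw [norm_mul]
    exact mul_le_mul (hg i j) (hxj j) (norm_nonneg _) hg0
  refine (Finset.sum_le_card_nsmul _ _ _ (fun i _ => hrow i)).trans ?_
  rw [nsmul_eq_mul, Finset.card_univ]
  apply le_of_eq
  ring

/-! ### Determinants and Schur complements -/

theorem norm_mul_entry_le {l m n : Type*} [Fintype m] {X : Matrix l m ℂ} {Y : Matrix m n ℂ}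
    {x y c : ℝ} (hc : (Fintype.card m : ℝ) ≤ c) (hx0 : 0 ≤ x) (hy0 : 0 ≤ y)
    (hX : ∀ i j, ‖X i j‖ ≤ x) (hY : ∀ i j, ‖Y i j‖ ≤ y) (i : l) (j : n) :
    ‖(X * Y) i j‖ ≤ c * (x * y) := by
  rw [Matrix.mul_apply]
  refine (norm_sum_le _ _).trans ?_
  refine (Finset.sum_le_card_nsmul _ _ (x * y) (fun k _ => ?_)).trans ?_
  · rw [norm_mul]
    exact mul_le_mul (hX i k) (hY k j) (norm_nonneg _) hx0
  · rw [nsmul_eq_mul, Finset.card_univ]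
    gcongr

/-- Leibniz expansion with `n! ≤ n^n`. Hadamard's inequality would gain nothing here, because `q` is
used to bound entries and sizes alike. -/
theorem norm_det_le {n : Type*} [Fintype n] [DecidableEq n] {X : Matrix n n ℂ} {x q : ℝ}
    (hq : (Fintype.card n : ℝ) ≤ q) (hx0 : 0 ≤ x) (hX : ∀ i j, ‖X i j‖ ≤ x) :
    ‖X.det‖ ≤ (q * x) ^ Fintype.card n := by
  have h := Matrix.det_le (A := X) (abv := IsAbsoluteValue.toAbsoluteValue (norm : ℂ → ℝ)) hX
  refine h.trans ?_
  rw [nsmul_eq_mul, mul_pow]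
  gcongr
  calc ((Fintype.card n).factorial : ℝ) ≤ ((Fintype.card n) ^ (Fintype.card n) : ℕ) := by
        exact_mod_cast Nat.factorial_le_pow _
    _ = (Fintype.card n : ℝ) ^ Fintype.card n := by push_cast; rfl
    _ ≤ q ^ Fintype.card n := by gcongr

/-- An adjugate entry is a determinant with one row replaced by a unit vector, whence the
requirement `1 ≤ x`. -/
theorem norm_adjugate_le {n : Type*} [Fintype n] [DecidableEq n] {X : Matrix n n ℂ} {x q : ℝ}
    (hq : (Fintype.card n : ℝ) ≤ q) (hx0 : 1 ≤ x) (hX : ∀ i j, ‖X i j‖ ≤ x) (i j : n) :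
    ‖X.adjugate i j‖ ≤ (q * x) ^ Fintype.card n := by
  rw [Matrix.adjugate_apply]
  refine norm_det_le hq (by linarith) (fun k l => ?_)
  rw [Matrix.updateRow_apply]
  split_ifs with hk
  · by_cases hl : l = i
    · subst hl; simpa using hx0
    · simp [hl]; linarith
  · exact hX k l

section Schur

variable {m n : Type*} [Fintype m] [DecidableEq m]

/-- The Schur complement of the upper left block. -/
noncomputable def schurComplement (T : Matrix (m ⊕ n) (m ⊕ n) ℂ) : Matrix n n ℂ :=
  T.toBlocks₂₂ - T.toBlocks₂₁ * T.toBlocks₁₁⁻¹ * T.toBlocks₁₂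

variable {T : Matrix (m ⊕ n) (m ⊕ n) ℂ} {q : ℝ}

theorem norm_schurComplement_le (hq : 1 ≤ q) (hm : (Fintype.card m : ℝ) ≤ q)
    (hT : ∀ i j, ‖T i j‖ ≤ q) (hAi : ∀ i j, ‖T.toBlocks₁₁⁻¹ i j‖ ≤ q) (i j : n) :
    ‖schurComplement T i j‖ ≤ 2 * q ^ 5 := by
  have hq0 : 0 ≤ q := by linarith
  have h1 := norm_mul_entry_le (X := T.toBlocks₂₁) (Y := T.toBlocks₁₁⁻¹) hm hq0 hq0
    (fun i j => hT _ _) hAi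
  have h2 := norm_mul_entry_le (Y := T.toBlocks₁₂) hm (by positivity) hq0 h1
    (fun i j => hT _ _) i j
  rw [schurComplement, Matrix.sub_apply]
  refine (norm_sub_le _ _).trans ?_
  have h3 : ‖T.toBlocks₂₂ i j‖ ≤ q := hT _ _
  have h4 : q ≤ q ^ 5 := le_self_pow₀ hq (by norm_num)
  nlinarith

variable [Fintype n] [DecidableEq n]

theorem det_schurComplement (hA : IsUnit T.toBlocks₁₁) :
    (schurComplement T).det = T.det / T.toBlocks₁₁.det := by
  have hd : T.toBlocks₁₁.det ≠ 0 := ((Matrix.isUnit_iff_isUnit_det _).1 hA).ne_zero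
  let := hA.invertible
  rw [eq_div_iff hd, mul_comm]
  conv_rhs => rw [← Matrix.fromBlocks_toBlocks T, Matrix.det_fromBlocks₁₁]
  rw [schurComplement, Matrix.invOf_eq_nonsing_inv]

theorem inv_eq_of_schurComplement (hA : IsUnit T.toBlocks₁₁)
    (hT : IsUnit T) :
    T⁻¹ = Matrix.fromBlocks
      (T.toBlocks₁₁⁻¹ + T.toBlocks₁₁⁻¹ * T.toBlocks₁₂ * (schurComplement T)⁻¹ * T.toBlocks₂₁ *
        T.toBlocks₁₁⁻¹)
      (-(T.toBlocks₁₁⁻¹ * T.toBlocks₁₂ * (schurComplement T)⁻¹))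
      (-((schurComplement T)⁻¹ * T.toBlocks₂₁ * T.toBlocks₁₁⁻¹)) (schurComplement T)⁻¹ := by
  let := hA.invertible
  have hT' : IsUnit (Matrix.fromBlocks T.toBlocks₁₁ T.toBlocks₁₂ T.toBlocks₂₁ T.toBlocks₂₂) := by
    rwa [Matrix.fromBlocks_toBlocks]
  have hS := Matrix.isUnit_fromBlocks_iff_of_invertible₁₁.1 hT'
  let := hS.invertible
  let := hT'.invertible
  have := Matrix.invOf_fromBlocks₁₁_eq T.toBlocks₁₁ T.toBlocks₁₂ T.toBlocks₂₁ T.toBlocks₂₂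
  simp only [Matrix.invOf_eq_nonsing_inv] at this
  rwa [Matrix.fromBlocks_toBlocks] at this

theorem norm_det_div_le (hA : IsUnit T.toBlocks₁₁) (hq : 1 ≤ q) (hm : (Fintype.card m : ℝ) ≤ q)
    (hn : (Fintype.card n : ℝ) ≤ q)
    (hT : ∀ i j, ‖T i j‖ ≤ q) (hAi : ∀ i j, ‖T.toBlocks₁₁⁻¹ i j‖ ≤ q) :
    ‖T.det / T.toBlocks₁₁.det‖ ≤ (2 * q ^ 6) ^ Fintype.card n := by
  rw [← det_schurComplement hA]
  have := norm_det_le hn (by positivity) (norm_schurComplement_le hq hm hT hAi)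
  rwa [show q * (2 * q ^ 5) = 2 * q ^ 6 by ring] at this

/-- The inverse Schur complement is the lower right block of `T⁻¹`, so a bound on `T⁻¹` bounds its
determinant from above, i.e. the quotient from below. Only a power `Fintype.card n` appears, not the
size of `T`. -/
theorem one_le_norm_det_div (hA : IsUnit T.toBlocks₁₁) (hTu : IsUnit T) (hq : 1 ≤ q)
    (hn : (Fintype.card n : ℝ) ≤ q) (hTi : ∀ i j, ‖T⁻¹ i j‖ ≤ q) :
    1 ≤ ‖T.det / T.toBlocks₁₁.det‖ * (q ^ 2) ^ Fintype.card n := by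
  have hd : T.toBlocks₁₁.det ≠ 0 := ((Matrix.isUnit_iff_isUnit_det _).1 hA).ne_zero
  have hdT : T.det ≠ 0 := ((Matrix.isUnit_iff_isUnit_det _).1 hTu).ne_zero
  rw [← det_schurComplement hA]
  have hS0 : (schurComplement T).det ≠ 0 := by
    rw [det_schurComplement hA]
    exact div_ne_zero hdT hd
  have hSi : ∀ i j, ‖(schurComplement T)⁻¹ i j‖ ≤ q := by
    intro i j
    have := hTi (Sum.inr i) (Sum.inr j)
    rw [inv_eq_of_schurComplement hA hTu] at this
    simpa using this
  have := norm_det_le hn (by linarith) hSi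
  rw [Matrix.det_nonsing_inv, Ring.inverse_eq_inv', norm_inv, ← sq] at this
  rwa [inv_le_iff_one_le_mul₀' (norm_pos_iff.2 hS0)] at this

/-- The only singular ingredient of the block inverse is the inverse Schur complement, which is its
adjugate over its determinant. Multiplying by the determinant therefore leaves a bounded quantity.
-/
theorem norm_inv_mul_norm_det_div_le (hA : IsUnit T.toBlocks₁₁) (hTu : IsUnit T) (hq : 1 ≤ q)
    (hm : (Fintype.card m : ℝ) ≤ q) (hn : (Fintype.card n : ℝ) ≤ q)
    (hT : ∀ i j, ‖T i j‖ ≤ q) (hAi : ∀ i j, ‖T.toBlocks₁₁⁻¹ i j‖ ≤ q) (i j : m ⊕ n) :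
    ‖T⁻¹ i j‖ * ‖T.det / T.toBlocks₁₁.det‖ ≤ 2 * q ^ 8 * (2 * q ^ 6) ^ Fintype.card n := by
  have hd : T.toBlocks₁₁.det ≠ 0 := ((Matrix.isUnit_iff_isUnit_det _).1 hA).ne_zero
  have hdT : T.det ≠ 0 := ((Matrix.isUnit_iff_isUnit_det _).1 hTu).ne_zero
  have hup := norm_det_div_le hA hq hm hn hT hAi
  have hSS := norm_schurComplement_le hq hm hT hAi
  have hq0 : 0 ≤ q := by linarith
  set f := ‖T.det / T.toBlocks₁₁.det‖ with hf
  have hf0 : 0 < f := norm_pos_iff.2 (div_ne_zero hdT hd)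
  set Q := (2 * q ^ 6) ^ Fintype.card n with hQ
  have hQ0 : 0 < Q := by positivity
  have hSi : ∀ i j, ‖(schurComplement T)⁻¹ i j‖ ≤ Q / f := by
    intro i j
    have h1 : 1 ≤ 2 * q ^ 5 := by
      have := one_le_pow₀ (n := 5) hq
      linarith
    have h2 := norm_adjugate_le hn h1 hSS i j
    rw [show q * (2 * q ^ 5) = 2 * q ^ 6 by ring, ← hQ] at h2
    rw [Matrix.inv_def, Ring.inverse_eq_inv', det_schurComplement hA, Matrix.smul_apply,
      smul_eq_mul, norm_mul, norm_inv, ← hf, ← div_eq_inv_mul]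
    gcongr
  have hB : ∀ i j, ‖T.toBlocks₁₂ i j‖ ≤ q := fun i j => hT _ _
  have hC : ∀ i j, ‖T.toBlocks₂₁ i j‖ ≤ q := fun i j => hT _ _
  have hσ : 0 ≤ Q / f := by positivity
  have hAB := norm_mul_entry_le hm hq0 hq0 hAi hB
  have hABS := norm_mul_entry_le hn (by positivity) hσ hAB hSi
  have hABSC := norm_mul_entry_le hn (by positivity) hq0 hABS hC
  have hABSCA := norm_mul_entry_le hm (by positivity) hq0 hABSC hAi
  have hSC := norm_mul_entry_le hn hσ hq0 hSi hC
  have hSCA := norm_mul_entry_le hm (by positivity) hq0 hSC hAi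
  have key : ‖T⁻¹ i j‖ ≤ q + q ^ 8 * (Q / f) := by
    have h4 : q ^ 4 * (Q / f) ≤ q ^ 8 * (Q / f) := by
      gcongr 1
      exact pow_le_pow_right₀ hq (by norm_num)
    have h0 : Q / f ≤ q ^ 8 * (Q / f) := le_mul_of_one_le_left hσ (one_le_pow₀ hq)
    rw [inv_eq_of_schurComplement hA hTu]
    rcases i with i | i <;> rcases j with j | j
    · rw [Matrix.fromBlocks_apply₁₁, Matrix.add_apply]
      refine (norm_add_le _ _).trans (add_le_add (hAi i j) ((hABSCA i j).trans (le_of_eq ?_)))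
      ring
    · rw [Matrix.fromBlocks_apply₁₂, Matrix.neg_apply, norm_neg]
      have := hABS i j
      rw [show q * (q * (q * q) * (Q / f)) = q ^ 4 * (Q / f) by ring] at this
      linarith
    · rw [Matrix.fromBlocks_apply₂₁, Matrix.neg_apply, norm_neg]
      have := hSCA i j
      rw [show q * (q * (Q / f * q) * q) = q ^ 4 * (Q / f) by ring] at this
      linarith
    · rw [Matrix.fromBlocks_apply₂₂]
      have := hSi i j
      linarith
  calc ‖T⁻¹ i j‖ * f ≤ (q + q ^ 8 * (Q / f)) * f := by gcongr
    _ = q * f + q ^ 8 * Q := by field_simp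
    _ ≤ q ^ 8 * Q + q ^ 8 * Q := by
        gcongr
        exact le_self_pow₀ hq (by norm_num)
    _ = _ := by ring

end Schur

/-! ### Uniform holomorphic extension along lines -/

/-- The coefficients of the expansions of an analytic function are locally uniformly controlled. -/
theorem exists_uniform_powerSeries {V : Type*} [NormedAddCommGroup V] [NormedSpace ℝ V]
    {F : V → ℝ} {p₀ : V} (hF : AnalyticAt ℝ F p₀) :
    ∃ r : NNReal, 0 < r ∧ ∃ C : NNReal, ∀ p ∈ Metric.ball p₀ r,
      ∃ q : FormalMultilinearSeries ℝ V ℝ, HasFPowerSeriesOnBall F q p r ∧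
        ∀ k, ‖q k‖₊ * r ^ k ≤ C := by
  obtain ⟨q, R, hq⟩ := hF
  obtain ⟨r, hr0, hrR⟩ := ENNReal.lt_iff_exists_nnreal_btwn.1 hq.r_pos
  have hr0' : 0 < r := by exact_mod_cast hr0
  have hhalf : ((r / 2 : NNReal) : ℝ≥0∞) + ((r / 2 : NNReal) : ℝ≥0∞) = r := by
    rw [← ENNReal.coe_add, add_halves]
  -- Moving the center by at most `r/2` and evaluating at radius `r/2` stays inside the convergence
  -- radius. One convergent double series then dominates the coefficients at all nearby centers.
  have hrad : ((r / 2 : NNReal) : ℝ≥0∞) + ((r / 2 : NNReal) : ℝ≥0∞) < q.radius := by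
    rw [hhalf]
    exact hrR.trans_le hq.r_le
  have hsum := q.changeOriginSeries_summable_aux₁ hrad
  refine ⟨r / 2, half_pos hr0', ∑' s : Σ k l : ℕ, { s : Finset (Fin (k + l)) // s.card = l },
      ‖q (s.1 + s.2.1)‖₊ * (r / 2) ^ s.2.1 * (r / 2) ^ s.1, fun p hp => ?_⟩
  set y := p - p₀ with hy
  have hyr : ‖y‖₊ ≤ r / 2 := by
    rw [← NNReal.coe_le_coe, coe_nnnorm, hy, ← dist_eq_norm]
    exact (Metric.mem_ball.1 hp).le
  have hyR : ((‖y‖₊ : NNReal) : ℝ≥0∞) < R := by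
    refine lt_of_le_of_lt (ENNReal.coe_le_coe.2 (hyr.trans ?_)) hrR
    exact half_le_self hr0'.le
  have hball := hq.changeOrigin hyR
  rw [hy, add_sub_cancel, ← hy] at hball
  refine ⟨q.changeOrigin y, hball.mono (by exact_mod_cast half_pos hr0') ?_, fun k => ?_⟩
  · refine ENNReal.le_sub_of_add_le_right ENNReal.coe_ne_top ?_
    refine le_trans ?_ hrR.le
    rw [← hhalf]
    gcongr
  · have h1 := q.nnnorm_changeOrigin_le k (x := y) (hyR.trans_le hq.r_le)
    have hsk := (NNReal.summable_sigma.1 hsum).1 k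
    have hsk' := q.changeOriginSeries_summable_aux₂ (hyR.trans_le hq.r_le) k
    calc ‖q.changeOrigin y k‖₊ * (r / 2) ^ k
        ≤ (∑' s : Σ l : ℕ, { s : Finset (Fin (k + l)) // s.card = l },
            ‖q (k + s.1)‖₊ * ‖y‖₊ ^ s.1) * (r / 2) ^ k := by gcongr
      _ = ∑' s : Σ l : ℕ, { s : Finset (Fin (k + l)) // s.card = l },
            ‖q (k + s.1)‖₊ * ‖y‖₊ ^ s.1 * (r / 2) ^ k := NNReal.tsum_mul_right _ _ |>.symm
      _ ≤ ∑' s : Σ l : ℕ, { s : Finset (Fin (k + l)) // s.card = l },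
            ‖q (k + s.1)‖₊ * (r / 2) ^ s.1 * (r / 2) ^ k := by
          refine Summable.tsum_le_tsum (fun s => by gcongr) (hsk'.mul_right _) hsk
      _ ≤ _ := by
          have h2 := (NNReal.summable_sigma.1 hsum).2
          rw [hsum.tsum_sigma' (NNReal.summable_sigma.1 hsum).1]
          exact h2.le_tsum k (fun _ _ => zero_le)

/-- `F` extends holomorphically along the line through `p` with direction `θ` to the disc of
radius `r`, with bound and Lipschitz constant at the center `C`. -/
def ExtendsAlong {V : Type*} [NormedAddCommGroup V] [NormedSpace ℝ V] (F : V → ℝ) (r C : ℝ)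
    (p θ : V) : Prop :=
  ∃ g : ℂ → ℂ, DifferentiableOn ℂ g (Metric.ball 0 r) ∧
    (∀ z, ‖z‖ < r → ‖g z‖ ≤ C ∧ ‖g z - g 0‖ ≤ C * ‖z‖) ∧
    ∀ t : ℝ, |t| < r → g t = F (p + t • θ)

theorem ExtendsAlong.mono {V : Type*} [NormedAddCommGroup V] [NormedSpace ℝ V] {F : V → ℝ}
    {r r' C C' : ℝ} {p θ : V} (h : ExtendsAlong F r C p θ) (hr : r' ≤ r) (hC : C ≤ C') :
    ExtendsAlong F r' C' p θ := by
  obtain ⟨g, h1, h2, h3⟩ := h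
  refine ⟨g, h1.mono (Metric.ball_subset_ball hr), fun z hz => ?_, fun t ht => h3 t (ht.trans_le hr)⟩
  have := h2 z (hz.trans_le hr)
  exact ⟨this.1.trans hC, this.2.trans (by gcongr)⟩

/-- Substituting a complex multiple of `θ` into the power series gives a one-variable series
dominated by a geometric series of ratio `1/2` on the half disc. The summands `2C` and `2C/r` are
its size and its Lipschitz constant at the center. -/
theorem extendsAlong_of_powerSeries {V : Type*} [NormedAddCommGroup V] [NormedSpace ℝ V]
    {F : V → ℝ} {p : V} {r C : NNReal} (hr : 0 < r) {q : FormalMultilinearSeries ℝ V ℝ}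
    (hq : HasFPowerSeriesOnBall F q p r) (hC : ∀ k, ‖q k‖₊ * r ^ k ≤ C) {θ : V} (hθ : ‖θ‖ ≤ 1) :
    ExtendsAlong F (r / 2) (2 * C + 2 * C / r) p θ := by
  have hr' : (0 : ℝ) < r := by exact_mod_cast hr
  set a : ℕ → ℝ := fun k => q k (fun _ => θ) with ha
  have hak : ∀ k, |a k| * r ^ k ≤ C := by
    intro k
    have h1 : |a k| ≤ ‖q k‖ := by
      refine ((q k).le_opNorm _).trans ?_
      refine mul_le_of_le_one_right (norm_nonneg _) ?_
      simpa using pow_le_one₀ (norm_nonneg θ) hθ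
    have h2 : ‖q k‖ * (r : ℝ) ^ k ≤ C := by exact_mod_cast hC k
    exact (mul_le_mul_of_nonneg_right h1 (by positivity)).trans h2
  have hterm : ∀ (k : ℕ) (z : ℂ), ‖(a k : ℂ) * z ^ k‖ ≤ C * (‖z‖ / r) ^ k := by
    intro k z
    rw [norm_mul, norm_pow, Complex.norm_real, Real.norm_eq_abs, div_pow, mul_div_assoc',
      le_div_iff₀ (by positivity)]
    calc |a k| * ‖z‖ ^ k * (r : ℝ) ^ k = |a k| * r ^ k * ‖z‖ ^ k := by ring
      _ ≤ C * ‖z‖ ^ k := by gcongr; exact hak k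
  have hzr : ∀ z : ℂ, ‖z‖ < r / 2 → ‖z‖ / r ≤ 1 / 2 := by
    intro z hz
    rw [div_le_iff₀ hr']
    linarith
  have hgeo : Summable (fun k : ℕ => (C : ℝ) * (1 / 2) ^ k) :=
    summable_geometric_two.mul_left _
  have hterm' : ∀ (k : ℕ) (z : ℂ), ‖z‖ < r / 2 → ‖(a k : ℂ) * z ^ k‖ ≤ C * (1 / 2) ^ k := by
    intro k z hz
    refine (hterm k z).trans ?_
    have := pow_le_pow_left₀ (by positivity) (hzr z hz) k
    gcongr
  have hsum : ∀ z : ℂ, ‖z‖ < r / 2 → Summable (fun k : ℕ => (a k : ℂ) * z ^ k) := fun z hz =>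
    Summable.of_norm_bounded hgeo (fun k => hterm' k z hz)
  refine ⟨fun z => ∑' k, (a k : ℂ) * z ^ k, ?_, ?_, ?_⟩
  · refine Complex.differentiableOn_tsum_of_summable_norm hgeo (fun k => ?_) Metric.isOpen_ball
      (fun k z hz => hterm' k z (by simpa using hz))
    fun_prop
  · intro z hz
    have hz2 := hzr z hz
    constructor
    · have h1 : ‖∑' k, (a k : ℂ) * z ^ k‖ ≤ ∑' k : ℕ, (C : ℝ) * (1 / 2) ^ k :=
        tsum_of_norm_bounded hgeo.hasSum (fun k => hterm' k z hz)
      rw [tsum_mul_left, tsum_geometric_two] at h1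
      have : 0 ≤ 2 * (C : ℝ) / r := by positivity
      linarith
    · have h0 : ∑' k, (a k : ℂ) * (0 : ℂ) ^ k = a 0 := by
        rw [tsum_eq_single 0 (fun k hk => by simp [hk])]
        simp
      have h1 : ∑' k, (a k : ℂ) * z ^ k = a 0 + ∑' k, (a (k + 1) : ℂ) * z ^ (k + 1) := by
        rw [(hsum z hz).tsum_eq_zero_add]
        simp
      simp only [h0, h1, add_sub_cancel_left]
      have hb : ∀ k : ℕ, ‖(a (k + 1) : ℂ) * z ^ (k + 1)‖ ≤ (C * (‖z‖ / r)) * (1 / 2) ^ k := by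
        intro k
        refine (hterm (k + 1) z).trans ?_
        rw [pow_succ', ← mul_assoc]
        have := pow_le_pow_left₀ (by positivity) hz2 k
        gcongr
      have h2 : ‖∑' k, (a (k + 1) : ℂ) * z ^ (k + 1)‖ ≤
          ∑' k : ℕ, ((C : ℝ) * (‖z‖ / r)) * (1 / 2) ^ k :=
        tsum_of_norm_bounded (summable_geometric_two.mul_left _).hasSum hb
      rw [tsum_mul_left, tsum_geometric_two] at h2
      refine h2.trans ?_
      have : 0 ≤ 2 * (C : ℝ) * ‖z‖ := by positivity
      calc (C : ℝ) * (‖z‖ / r) * 2 = 2 * C / r * ‖z‖ := by ring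
        _ ≤ _ := by nlinarith
  · intro t ht
    have hmem : p + t • θ ∈ Metric.eball p (r : ℝ≥0∞) := by
      rw [Metric.eball_coe, Metric.mem_ball, dist_eq_norm, add_sub_cancel_left, norm_smul,
        Real.norm_eq_abs]
      nlinarith [abs_nonneg t, norm_nonneg θ]
    have h1 := hq.hasSum_sub hmem
    simp only [add_sub_cancel_left] at h1
    have hterms : (fun k => a k * t ^ k) = fun k => q k (fun _ => t • θ) := by
      funext k
      have := (q k).map_smul_univ (fun _ => t) (fun _ => θ)
      simp only [Finset.prod_const, Finset.card_univ, Fintype.card_fin, smul_eq_mul] at this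
      rw [this, ha, mul_comm]
    have h2 : HasSum (fun k => a k * t ^ k) (F (p + t • θ)) := by
      rw [hterms]
      exact h1
    have h3 : HasSum (fun k => (a k : ℂ) * (t : ℂ) ^ k) ((F (p + t • θ) : ℝ) : ℂ) := by
      have := Complex.hasSum_ofReal.2 h2
      simpa using this
    exact h3.tsum_eq

theorem toTorus_add {d : ℕ} {b : Fin d → ℕ} (x y : Vec b) :
    toTorus (x + y) = toTorus x + toTorus y := by
  funext i l
  simp [toTorus]

/-- A real analytic function on the torus extends holomorphically along all lines, uniformly. -/
theorem exists_extendsAlong {d : ℕ} {b : Fin d → ℕ} {v : Torus b → ℝ}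
    (hv : IsAnalyticOnTorus v) :
    ∃ r : ℝ, 0 < r ∧ ∃ C : ℝ, 1 ≤ C ∧ ∀ p θ : Vec b, ‖θ‖ ≤ 1 →
      ExtendsAlong (fun x => v (toTorus x)) r C p θ := by
  have hK : IsCompact (Set.Icc (0 : Vec b) 1) := isCompact_Icc
  obtain ⟨r, hr, C, hC, h⟩ := hK.induction_on
    (p := fun A => ∃ r : ℝ, 0 < r ∧ ∃ C : ℝ, 1 ≤ C ∧ ∀ p ∈ A, ∀ θ : Vec b, ‖θ‖ ≤ 1 →
      ExtendsAlong (fun x => v (toTorus x)) r C p θ)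
    ⟨1, one_pos, 1, le_rfl, fun p hp => absurd hp (Set.notMem_empty p)⟩
    (by
      rintro A B hAB ⟨r, hr, C, hC, h⟩
      exact ⟨r, hr, C, hC, fun p hp => h p (hAB hp)⟩)
    (by
      rintro A B ⟨r, hr, C, hC, h⟩ ⟨r', hr', C', hC', h'⟩
      refine ⟨min r r', lt_min hr hr', max C C', le_max_of_le_left hC, fun p hp θ hθ => ?_⟩
      rcases hp with hp | hp
      · exact (h p hp θ hθ).mono (min_le_left _ _) (le_max_left _ _)
      · exact (h' p hp θ hθ).mono (min_le_right _ _) (le_max_right _ _))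
    (by
      intro x _
      obtain ⟨r, hr, C, h⟩ := exists_uniform_powerSeries (hv x)
      have hr' : (0 : ℝ) < r := by exact_mod_cast hr
      refine ⟨_, mem_nhdsWithin_of_mem_nhds (Metric.ball_mem_nhds x hr'), r / 2, by positivity,
        max 1 (2 * C + 2 * C / r), le_max_left _ _, fun p hp θ hθ => ?_⟩
      obtain ⟨q, hq, hqC⟩ := h p hp
      exact (extendsAlong_of_powerSeries hr hq hqC hθ).mono le_rfl (le_max_right _ _))
  -- Periodicity reduces every base point to its fractional part in the compact unit cube.
  refine ⟨r, hr, C, hC, fun p θ hθ => ?_⟩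
  obtain ⟨g, h1, h2, h3⟩ := h (fun i l => Int.fract (p i l))
    ⟨fun i l => Int.fract_nonneg _, fun i l => (Int.fract_lt_one _).le⟩ θ hθ
  refine ⟨g, h1, h2, fun t ht => ?_⟩
  rw [h3 t ht]
  have hp : toTorus (fun i l => Int.fract (p i l)) = toTorus p := by
    funext i l
    exact AddCircle.coe_fract _
  simp only [toTorus_add, hp]

/-! ### Geometry of elementary regions -/

theorem mem_cube {d : ℕ} {N : ℝ} {n : Fin d → ℤ} :
    n ∈ cube d N ↔ ∀ i, -⌊N⌋ ≤ n i ∧ n i ≤ ⌊N⌋ := by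
  simp only [cube, Finset.mem_Icc, Pi.le_def, forall_and]

theorem mem_notchedCube {d : ℕ} {N : ℝ} {ς : Fin d → SignType} {n : Fin d → ℤ} :
    n ∈ notchedCube N ς ↔
      (∀ i, -⌊N⌋ ≤ n i ∧ n i ≤ ⌊N⌋) ∧ ∃ i, ς i ≠ 0 ∧ SignType.sign (n i) ≠ ς i := by
  rw [notchedCube, Finset.mem_filter, mem_cube]
  push Not
  rfl

theorem IsElementaryZero.subset_cube {d : ℕ} {N : ℝ} {Q : Finset (Fin d → ℤ)}
    (hQ : IsElementaryZero N Q) : Q ⊆ cube d N := by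
  rcases hQ with rfl | ⟨ς, _, rfl⟩
  · exact subset_rfl
  · exact Finset.filter_subset _ _

/-- The notch removes only strict inequalities, so the origin survives. Hence the base point of a
translate lies in the translate, and goodness is needed only at sites of the large region. -/
theorem IsElementaryZero.zero_mem {d : ℕ} {N : ℝ} (hN : 0 ≤ N) {Q : Finset (Fin d → ℤ)}
    (hQ : IsElementaryZero N Q) : 0 ∈ Q := by
  have h0 : 0 ≤ ⌊N⌋ := Int.floor_nonneg.2 hN
  rcases hQ with rfl | ⟨ς, ⟨i, _, _, hi, _⟩, rfl⟩
  · rw [mem_cube]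
    intro i
    simp [h0]
  · rw [mem_notchedCube]
    refine ⟨fun i => by simp [h0], i, hi, ?_⟩
    simpa using hi.symm

theorem mem_image_add {d : ℕ} {c p : Fin d → ℤ} {Q : Finset (Fin d → ℤ)} :
    p ∈ Q.image (fun m => c + m) ↔ p - c ∈ Q := by
  rw [Finset.mem_image]
  constructor
  · rintro ⟨q, hq, rfl⟩
    simpa using hq
  · exact fun h => ⟨p - c, h, by simp⟩

/-- Integer form of nearness, which turns the covering argument into linear arithmetic over `ℤ`. -/
theorem two_mul_sub_le_floor {d : ℕ} {N : ℝ} {k p : Fin d → ℤ} (h : ‖k - p‖ < N / 2) (i : Fin d) :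
    2 * (k i - p i) ≤ ⌊N⌋ ∧ 2 * (p i - k i) ≤ ⌊N⌋ := by
  have h1 : |((k i - p i : ℤ) : ℝ)| < N / 2 := by
    refine lt_of_le_of_lt ?_ h
    have := norm_le_pi_norm (k - p) i
    rwa [Pi.sub_apply, Int.norm_eq_abs] at this
  rw [abs_lt] at h1
  constructor <;> rw [Int.le_floor] <;> push_cast at h1 ⊢ <;> linarith

/-- Every point of an elementary region lies well inside a smaller elementary region. -/
theorem IsElementaryZero.exists_subregion {d : ℕ} {N N' : ℝ} (hN' : 0 ≤ N')
    (hNN : 2 * ⌊N'⌋ ≤ ⌊N⌋) {Q : Finset (Fin d → ℤ)} (hQ : IsElementaryZero N Q)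
    {k : Fin d → ℤ} (hk : k ∈ Q) :
    ∃ W, IsElementary N' W ∧ k ∈ W ∧ W ⊆ Q ∧ ∀ p ∈ Q \ W, N' / 2 ≤ ‖k - p‖ := by
  have hm0 : 0 ≤ ⌊N'⌋ := Int.floor_nonneg.2 hN'
  set m := ⌊N'⌋ with hm
  set M := ⌊N⌋ with hM
  have hcube := fun p (hp : p ∈ Q) => mem_cube.1 (hQ.subset_cube hp)
  simp only [← hM] at hcube
  -- Clamping `k` so that the cube of radius `m` around `c₀` stays in the large cube. Where clamping
  -- acts, the faces coincide and no nearby point of `Q` is lost.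
  set c₀ : Fin d → ℤ := fun i => max (-(M - m)) (min (M - m) (k i)) with hc₀
  have hc₀k : ∀ i, -(M - m) ≤ c₀ i ∧ c₀ i ≤ M - m ∧ k i - c₀ i ≤ m ∧ c₀ i - k i ≤ m := by
    intro i
    have := hcube k hk i
    simp only [hc₀]
    omega
  have hc₀p : ∀ p ∈ Q, ∀ i, 2 * (k i - p i) ≤ m → 2 * (p i - k i) ≤ m →
      p i - c₀ i ≤ m ∧ c₀ i - p i ≤ m := by
    intro p hp i h1 h2
    have h3 := hcube p hp i
    have h4 := hcube k hk i
    simp only [hc₀]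
    omega
  suffices h : ∃ W, IsElementary N' W ∧ k ∈ W ∧ W ⊆ Q ∧ ∀ p ∈ Q,
      (∀ i, 2 * (k i - p i) ≤ m ∧ 2 * (p i - k i) ≤ m) → p ∈ W by
    obtain ⟨W, h1, h2, h3, h4⟩ := h
    refine ⟨W, h1, h2, h3, fun p hp => ?_⟩
    by_contra hlt
    push Not at hlt
    rw [Finset.mem_sdiff] at hp
    exact hp.2 (h4 p hp.1 (two_mul_sub_le_floor hlt))
  rcases hQ with rfl | ⟨ς, hς, rfl⟩
  · refine ⟨(cube d N').image (fun q => c₀ + q), ⟨c₀, _, Or.inl rfl, rfl⟩, ?_, ?_, ?_⟩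
    · rw [mem_image_add, mem_cube]
      intro i
      have := hc₀k i
      simp only [Pi.sub_apply]
      omega
    · intro p hp
      rw [mem_image_add, mem_cube] at hp
      rw [mem_cube]
      intro i
      have h1 := hp i
      have h2 := hc₀k i
      simp only [Pi.sub_apply] at h1
      omega
    · intro p hp hnear
      rw [mem_image_add, mem_cube]
      intro i
      have h1 := hc₀p p hp i (hnear i).1 (hnear i).2
      simp only [Pi.sub_apply]
      omega
  -- First case: one coordinate alone certifies that `k` and all its neighbors in `Q` avoid the
  -- notch. A full cube then works, once it is pushed to the admissible side of the hyperplane of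
  -- that coordinate.
  by_cases hcase : ∃ i, ς i ≠ 0 ∧ SignType.sign (k i) ≠ ς i ∧
      ∀ p ∈ notchedCube N ς, (∀ i, 2 * (k i - p i) ≤ m ∧ 2 * (p i - k i) ≤ m) →
        SignType.sign (p i) ≠ ς i
  · obtain ⟨j, hj0, hjk, hjp⟩ := hcase
    obtain ⟨e, he1, he2, he3, he4⟩ : ∃ e : ℤ, (-(M - m) ≤ e ∧ e ≤ M - m) ∧
        (k j - e ≤ m ∧ e - k j ≤ m) ∧
        (∀ p ∈ notchedCube N ς, (∀ i, 2 * (k i - p i) ≤ m ∧ 2 * (p i - k i) ≤ m) →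
          p j - e ≤ m ∧ e - p j ≤ m) ∧
        ∀ t : ℤ, t - e ≤ m → e - t ≤ m → SignType.sign t ≠ ς j := by
      have h4 := hcube k hk j
      rcases hs : ς j with _ | _ | _
      · exact absurd hs hj0
      · simp only [hs, SignType.neg_eq_neg_one, ne_eq, sign_eq_neg_one_iff, not_lt] at hjk hjp ⊢
        refine ⟨max (c₀ j) m, ?_, ?_, fun p hp hnear => ?_, fun t ht ht' => ?_⟩
        · have := hc₀k j
          omega
        · have := hc₀k j
          omega
        · have h1 := hc₀p p hp j (hnear j).1 (hnear j).2
          have h2 := hjp p hp hnear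
          have h3 := hnear j
          omega
        · omega
      · simp only [hs, SignType.pos_eq_one, ne_eq, sign_eq_one_iff, not_lt] at hjk hjp ⊢
        refine ⟨min (c₀ j) (-m), ?_, ?_, fun p hp hnear => ?_, fun t ht ht' => ?_⟩
        · have := hc₀k j
          omega
        · have := hc₀k j
          omega
        · have h1 := hc₀p p hp j (hnear j).1 (hnear j).2
          have h2 := hjp p hp hnear
          have h3 := hnear j
          omega
        · omega
    set c := Function.update c₀ j e with hc
    have hcj : c j = e := by simp [hc]
    have hcne : ∀ i, i ≠ j → c i = c₀ i := fun i hi => by simp [hc, hi]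
    refine ⟨(cube d N').image (fun q => c + q), ⟨c, _, Or.inl rfl, rfl⟩, ?_, ?_, ?_⟩
    · rw [mem_image_add, mem_cube]
      intro i
      simp only [Pi.sub_apply]
      by_cases hi : i = j
      · subst hi
        omega
      · have := hc₀k i
        rw [hcne i hi]
        omega
    · intro p hp
      rw [mem_image_add, mem_cube] at hp
      simp only [Pi.sub_apply] at hp
      rw [mem_notchedCube]
      refine ⟨fun i => ?_, j, hj0, ?_⟩
      · have h1 := hp i
        by_cases hi : i = j
        · subst hi
          omega
        · have := hc₀k i
          rw [hcne i hi] at h1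
          omega
      · have h1 := hp j
        exact he4 (p j) (by omega) (by omega)
    · intro p hp hnear
      rw [mem_image_add, mem_cube]
      intro i
      simp only [Pi.sub_apply]
      by_cases hi : i = j
      · subst hi
        have := he3 p hp hnear
        omega
      · have h1 := hc₀p p hp i (hnear i).1 (hnear i).2
        rw [hcne i hi]
        omega
  -- Otherwise `k` is close to a corner of the notch: a sign change between nearby points puts the
  -- corresponding coordinate of `k` within `m/2` of `0`, and this happens in two different
  -- coordinates. That is why elementary regions have at least two active signs.
  · push Not at hcase
    have hsmall : ∀ p ∈ notchedCube N ς, (∀ i, 2 * (k i - p i) ≤ m ∧ 2 * (p i - k i) ≤ m) →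
        ∀ i, ς i ≠ 0 → SignType.sign (p i) ≠ ς i → 2 * k i ≤ m ∧ -(2 * k i) ≤ m := by
      intro p hp hnear i hi hpi
      have h1 := hnear i
      by_cases hki : SignType.sign (k i) = ς i
      · rw [← hki] at hpi
        by_contra hcon
        apply hpi
        rcases lt_trichotomy (k i) 0 with h0 | h0 | h0
        · rw [sign_neg h0, sign_neg (by omega)]
        · omega
        · rw [sign_pos h0, sign_pos (by omega)]
      · obtain ⟨p', hp', hnear', hs'⟩ := hcase i hi hki
        have h2 := hnear' i
        rw [← hs'] at hki
        by_contra hcon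
        apply hki
        rcases lt_trichotomy (k i) 0 with h0 | h0 | h0
        · rw [sign_neg h0, sign_neg (by omega)]
        · omega
        · rw [sign_pos h0, sign_pos (by omega)]
    have hself : ∀ i, 2 * (k i - k i) ≤ m ∧ 2 * (k i - k i) ≤ m := fun i => by omega
    obtain ⟨i, hi, hki⟩ := (mem_notchedCube.1 hk).2
    have hism := hsmall k hk hself i hi hki
    obtain ⟨p, hp, hnear, hpi⟩ := hcase i hi hki
    obtain ⟨i', hi', hpi'⟩ := (mem_notchedCube.1 hp).2
    have hi'sm := hsmall p hp hnear i' hi' hpi'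
    have hii' : i ≠ i' := by
      rintro rfl
      exact hpi' hpi
    -- Only the hyperplanes near `k` are kept. The center is `0` in the active coordinates, so that
    -- the small notch lines up with the large one.
    set ς' : Fin d → SignType := fun i => if 2 * k i ≤ m ∧ -(2 * k i) ≤ m then ς i else 0 with hς'
    have hς'1 : ∀ i, 2 * k i ≤ m ∧ -(2 * k i) ≤ m → ς' i = ς i := fun i hi => if_pos hi
    have hς'2 : ∀ i, ς' i ≠ 0 → 2 * k i ≤ m ∧ -(2 * k i) ≤ m := by
      intro i hi
      by_contra hcon
      exact hi (if_neg hcon)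
    set c : Fin d → ℤ := fun i => if ς' i ≠ 0 then 0 else c₀ i with hc
    have hc1 : ∀ i, ς' i ≠ 0 → c i = 0 := fun i hi => if_pos hi
    have hc2 : ∀ i, ¬ ς' i ≠ 0 → c i = c₀ i := fun i hi => if_neg hi
    refine ⟨(notchedCube N' ς').image (fun q => c + q), ⟨c, _, Or.inr ⟨ς', ?_, rfl⟩, rfl⟩,
      ?_, ?_, ?_⟩
    · exact ⟨i, i', hii', by rwa [hς'1 i hism], by rwa [hς'1 i' hi'sm]⟩
    · rw [mem_image_add, mem_notchedCube]
      simp only [Pi.sub_apply]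
      refine ⟨fun l => ?_, i, by rwa [hς'1 i hism], ?_⟩
      · by_cases hl : ς' l ≠ 0
        · have := hς'2 l hl
          rw [hc1 l hl]
          omega
        · have := hc₀k l
          rw [hc2 l hl]
          omega
      · rw [hc1 i (by rwa [hς'1 i hism]), sub_zero, hς'1 i hism]
        exact hki
    · intro q hq
      rw [mem_image_add, mem_notchedCube] at hq
      simp only [Pi.sub_apply] at hq
      obtain ⟨hqc, l, hl, hql⟩ := hq
      rw [mem_notchedCube]
      refine ⟨fun l => ?_, l, ?_, ?_⟩
      · have h1 := hqc l
        by_cases hl : ς' l ≠ 0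
        · rw [hc1 l hl] at h1
          omega
        · have := hc₀k l
          rw [hc2 l hl] at h1
          omega
      · rwa [← hς'1 l (hς'2 l hl)]
      · rwa [hc1 l hl, sub_zero, hς'1 l (hς'2 l hl)] at hql
    · intro q hq hnearq
      rw [mem_image_add, mem_notchedCube]
      simp only [Pi.sub_apply]
      obtain ⟨l, hl, hql⟩ := (mem_notchedCube.1 hq).2
      have hlsm := hsmall q hq hnearq l hl hql
      have hl' : ς' l ≠ 0 := by rwa [hς'1 l hlsm]
      refine ⟨fun l => ?_, l, hl', ?_⟩
      · have h1 := hnearq l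
        by_cases hl : ς' l ≠ 0
        · have := hς'2 l hl
          rw [hc1 l hl]
          omega
        · have := hc₀p q hq l h1.1 h1.2
          rw [hc2 l hl]
          omega
      · rwa [hc1 l hl', sub_zero, hς'1 l hlsm]

theorem IsElementary.exists_subregion {d : ℕ} {N N' : ℝ} (hN' : 0 ≤ N')
    (hNN : 2 * ⌊N'⌋ ≤ ⌊N⌋) {Λ : Finset (Fin d → ℤ)} (hΛ : IsElementary N Λ)
    {k : Fin d → ℤ} (hk : k ∈ Λ) :
    ∃ W, IsElementary N' W ∧ k ∈ W ∧ W ⊆ Λ ∧ ∀ p ∈ Λ \ W, N' / 2 ≤ ‖k - p‖ := by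
  obtain ⟨n, Q, hQ, rfl⟩ := hΛ
  rw [mem_image_add] at hk
  obtain ⟨_, ⟨c, Q', hQ', rfl⟩, h2, h3, h4⟩ := hQ.exists_subregion hN' hNN hk
  rw [mem_image_add] at h2
  refine ⟨Q'.image (fun q => (n + c) + q), ⟨n + c, Q', hQ', rfl⟩, ?_, ?_, ?_⟩
  · rw [mem_image_add]
    rwa [sub_sub] at h2
  · intro p hp
    rw [mem_image_add] at hp ⊢
    apply h3
    rw [mem_image_add, sub_sub]
    exact hp
  · intro p hp
    rw [Finset.mem_sdiff, mem_image_add, mem_image_add] at hp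
    have := h4 (p - n) (by rw [Finset.mem_sdiff, mem_image_add, sub_sub]; exact hp)
    rwa [sub_sub_sub_cancel_right] at this

theorem IsElementary.card_le {d : ℕ} {N : ℝ} (hN : 0 ≤ N) {Λ : Finset (Fin d → ℤ)}
    (hΛ : IsElementary N Λ) : (Λ.card : ℝ) ≤ (2 * N + 1) ^ d := by
  obtain ⟨n, Q, hQ, rfl⟩ := hΛ
  have h0 : 0 ≤ ⌊N⌋ := Int.floor_nonneg.2 hN
  have h1 : (Q.image (fun m => n + m)).card ≤ (cube d N).card :=
    Finset.card_image_le.trans (Finset.card_le_card hQ.subset_cube)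
  have h2 : (cube d N).card = (2 * ⌊N⌋ + 1).toNat ^ d := by
    rw [cube, Pi.card_Icc]
    simp only [Int.card_Icc, Finset.prod_const, Finset.card_univ, Fintype.card_fin]
    congr 2
    ring
  rw [h2] at h1
  have h3 : ((2 * ⌊N⌋ + 1).toNat : ℝ) ≤ 2 * N + 1 := by
    have h4 : ((2 * ⌊N⌋ + 1).toNat : ℤ) = 2 * ⌊N⌋ + 1 := Int.toNat_of_nonneg (by omega)
    have h5 : ((2 * ⌊N⌋ + 1).toNat : ℝ) = 2 * ⌊N⌋ + 1 := by exact_mod_cast h4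
    rw [h5]
    have := Int.floor_le N
    linarith
  calc _ ≤ (((2 * ⌊N⌋ + 1).toNat ^ d : ℕ) : ℝ) := by exact_mod_cast h1
    _ = ((2 * ⌊N⌋ + 1).toNat : ℝ) ^ d := by push_cast; rfl
    _ ≤ _ := by gcongr

/-- The cardinality of a finite set of lattice points in terms of its diameter. -/
theorem card_le_of_diam {d : ℕ} {A : Finset (Fin d → ℤ)} {D : ℝ} (hD : 0 ≤ D)
    (hA : Metric.diam (A : Set (Fin d → ℤ)) ≤ D) : (A.card : ℝ) ≤ (2 * D + 1) ^ d := by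
  rcases A.eq_empty_or_nonempty with rfl | ⟨a, ha⟩
  · simp
    positivity
  · have hsub : A ⊆ (cube d D).image (fun m => a + m) := by
      intro p hp
      rw [mem_image_add, mem_cube]
      intro i
      have h1 : dist p a ≤ D := (Metric.dist_le_diam_of_mem A.finite_toSet.isBounded hp ha).trans hA
      have h2 : |((p i - a i : ℤ) : ℝ)| ≤ D := by
        refine le_trans ?_ h1
        rw [dist_eq_norm]
        have := norm_le_pi_norm (p - a) i
        rwa [Pi.sub_apply, Int.norm_eq_abs] at this
      rw [← abs_le, Pi.sub_apply, Int.le_floor]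
      push_cast at h2 ⊢
      exact h2
    calc (A.card : ℝ) ≤ ((cube d D).image (fun m => a + m)).card := by
          exact_mod_cast Finset.card_le_card hsub
      _ ≤ _ := IsElementary.card_le hD ⟨a, _, Or.inl rfl, rfl⟩

/-! ### Restricted operators with a general potential -/

section Operator

variable {d : ℕ} {b : Fin d → ℕ} {S : Matrix (Fin d → ℤ) (Fin d → ℤ) ℂ} {v : Torus b → ℝ}
  {lam ρ : ℝ}

/-- The entries of `lam⁻¹ S + w - E` for a complex potential `w`. -/
noncomputable def opEntry (S : Matrix (Fin d → ℤ) (Fin d → ℤ) ℂ) (lam E : ℝ)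
    (w : (Fin d → ℤ) → ℂ) (n n' : Fin d → ℤ) : ℂ :=
  (lam : ℂ)⁻¹ * S n n' + if n = n' then w n - E else 0

/-- The restriction of `lam⁻¹ S + w - E` to `Λ`. -/
noncomputable def opMatrix (S : Matrix (Fin d → ℤ) (Fin d → ℤ) ℂ) (lam E : ℝ)
    (w : (Fin d → ℤ) → ℂ) (Λ : Finset (Fin d → ℤ)) : Matrix Λ Λ ℂ :=
  Matrix.of fun n n' => opEntry S lam E w n.1 n'.1

theorem boxOperator_eq_opMatrix (hlam : 1 < lam) (ω : Vec b) (Λ : Finset (Fin d → ℤ)) (E : ℝ)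
    (x : Torus b) :
    boxOperator S v lam ω Λ E x = opMatrix S lam E (fun n => (v (shift x ω n) : ℂ)) Λ := by
  have hl : (lam : ℂ) ≠ 0 := by
    rw [ne_eq, Complex.ofReal_eq_zero]
    linarith
  ext n n'
  simp only [boxOperator, hamiltonian, opMatrix, opEntry, Matrix.submatrix_apply, Matrix.sub_apply,
    Matrix.smul_apply, Matrix.add_apply, Matrix.diagonal_apply, Matrix.one_apply, Matrix.of_apply,
    smul_eq_mul]
  split_ifs
  · push_cast
    field_simp
    ring
  · ring

theorem shift_shift (x : Torus b) (ω : Vec b) (c q : Fin d → ℤ) :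
    shift (shift x ω c) ω q = shift x ω (c + q) := by
  funext i l
  simp only [shift, toTorus, Pi.add_apply, Pi.smul_apply, smul_eq_mul, Int.cast_add, add_mul,
    AddCircle.coe_add, add_assoc]

/-- Since `lam⁻¹ ≤ 1`, the bounds are uniform in `lam`; the potential enters only on the diagonal.
-/
theorem norm_opEntry_off_le (hS : IsHopping ρ S) (hlam : 1 < lam) {E : ℝ} {w : (Fin d → ℤ) → ℂ}
    {n n' : Fin d → ℤ} (h : n ≠ n') : ‖opEntry S lam E w n n'‖ ≤ Real.exp (-ρ * ‖n - n'‖) := by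
  rw [opEntry, if_neg h, add_zero, norm_mul, norm_inv, Complex.norm_real, Real.norm_eq_abs,
    abs_of_pos (by linarith)]
  have h1 : lam⁻¹ ≤ 1 := inv_le_one_of_one_le₀ hlam.le
  have h2 := hS.decay n n'
  have h3 : 0 ≤ lam⁻¹ := by positivity
  nlinarith [norm_nonneg (S n n')]

theorem norm_opEntry_le (hS : IsHopping ρ S) (hρ : 0 < ρ) (hlam : 1 < lam) {E C : ℝ}
    {w : (Fin d → ℤ) → ℂ} {n n' : Fin d → ℤ} (hw : ‖w n‖ ≤ C) :
    ‖opEntry S lam E w n n'‖ ≤ 1 + C + |E| := by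
  have hexp : ∀ t : ℝ, 0 ≤ t → Real.exp (-ρ * t) ≤ 1 := fun t ht => by
    rw [Real.exp_le_one_iff]
    nlinarith
  have hC : 0 ≤ C := (norm_nonneg _).trans hw
  by_cases h : n = n'
  · rw [opEntry, if_pos h]
    have h1 : ‖(lam : ℂ)⁻¹ * S n n'‖ ≤ 1 := by
      rw [norm_mul, norm_inv, Complex.norm_real, Real.norm_eq_abs, abs_of_pos (by linarith)]
      have h1 : lam⁻¹ ≤ 1 := inv_le_one_of_one_le₀ hlam.le
      have h2 := (hS.decay n n').trans (hexp _ (norm_nonneg _))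
      exact mul_le_one₀ h1 (norm_nonneg _) h2
    have h2 : ‖w n - E‖ ≤ C + |E| := by
      refine (norm_sub_le _ _).trans (add_le_add hw ?_)
      rw [Complex.norm_real, Real.norm_eq_abs]
    exact (norm_add_le _ _).trans (by linarith)
  · refine (norm_opEntry_off_le hS hlam h).trans ((hexp _ (norm_nonneg _)).trans ?_)
    have := abs_nonneg E
    linarith

/-- A row of the Green's function of a good elementary region. -/
theorem exists_green_row (hS : IsHopping ρ S) (hlam : 1 < lam) {ω : Vec b} {ρbar N E : ℝ}
    {x : Torus b} {c : Fin d → ℤ} (hgood : IsGood S v lam ω ρbar N E (shift x ω c))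
    {Q : Finset (Fin d → ℤ)} (hQ : IsElementaryZero N Q) {k : Fin d → ℤ}
    (hk : k ∈ Q.image (fun m => c + m)) :
    ∃ g : (Fin d → ℤ) → ℂ, (∀ n, ‖g n‖ ≤ Real.exp (Real.sqrt N)) ∧
      (∀ n, N / 10 ≤ ‖k - n‖ → ‖g n‖ ≤ Real.exp (-ρbar * ‖k - n‖)) ∧
      ∀ n' ∈ Q.image (fun m => c + m), ∑ n ∈ Q.image (fun m => c + m),
        g n * opEntry S lam E (fun n => (v (shift x ω n) : ℂ)) n n' = if k = n' then 1 else 0 := by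
  obtain ⟨h1, h2⟩ := hgood Q hQ
  set G := green S v lam ω Q E (shift x ω c) with hG
  rw [mem_image_add] at hk
  have hunit : IsUnit (boxOperator S v lam ω Q E (shift x ω c)) := by
    by_contra hcon
    rw [greenNorm, if_neg hcon] at h1
    exact absurd h1 (not_le.2 ENNReal.ofReal_lt_top)
  rw [greenNorm, if_pos hunit, ENNReal.ofReal_le_ofReal_iff (Real.exp_pos _).le] at h1
  obtain ⟨γ, hγ⟩ : ∃ γ : Q → ℂ, ∀ j, γ j = G ⟨k - c, hk⟩ j := ⟨_, fun _ => rfl⟩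
  refine ⟨fun n => if h : n - c ∈ Q then γ ⟨n - c, h⟩ else 0, fun n => ?_,
    fun n hn => ?_, fun n' hn' => ?_⟩
  · dsimp only
    split_ifs with h
    · rw [hγ]
      exact (norm_entry_le_toEuclideanCLM _ _ _).trans h1
    · rw [norm_zero]
      exact (Real.exp_pos _).le
  · dsimp only
    split_ifs with h
    · rw [hγ]
      have := h2 ⟨k - c, hk⟩ ⟨n - c, h⟩
      simp only [sub_sub_sub_cancel_right] at this
      exact this hn
    · rw [norm_zero]
      exact (Real.exp_pos _).le
  · rw [mem_image_add] at hn'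
    rw [Finset.sum_image (fun a _ a' _ h => by simpa using h), ← Finset.sum_coe_sort]
    have hprod : G * boxOperator S v lam ω Q E (shift x ω c) = 1 :=
      Matrix.nonsing_inv_mul _ ((Matrix.isUnit_iff_isUnit_det _).1 hunit)
    have hentry := congrFun (congrFun hprod ⟨k - c, hk⟩) ⟨n' - c, hn'⟩
    rw [Matrix.mul_apply, Matrix.one_apply, boxOperator_eq_opMatrix hlam] at hentry
    simp only [Subtype.mk.injEq, sub_left_inj] at hentry
    rw [← hentry]
    refine Finset.sum_congr rfl (fun q _ => ?_)
    have hq : c + q.1 - c = q.1 := by abel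
    have hq' : c + q.1 - c ∈ Q := by rw [hq]; exact q.2
    rw [← hγ]
    dsimp only
    rw [dif_pos hq']
    congr 1
    · congr 1
      exact Subtype.ext hq
    · simp only [opMatrix, Matrix.of_apply, opEntry, shift_shift]
      -- The Toeplitz property identifies the operator on `c + Q` at `x` with the operator on `Q` at
      -- `x + cω`.
      have hT := hS.toeplitz q.1 (n' - c) c
      rw [sub_add_cancel, add_comm q.1 c] at hT
      rw [hT]
      have hiff : c + q.1 = n' ↔ q.1 = n' - c := by
        rw [eq_sub_iff_add_eq, add_comm]
      simp only [hiff]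

/-- If a region is covered by good regions then its restricted operator is invertible. -/
theorem isUnit_of_cover (hS : IsHopping ρ S) (hρ : 0 < ρ) (hlam : 1 < lam) {E ρ₀ ρbar N L : ℝ}
    (hN : 0 ≤ N) (hρ₀ : 0 < ρ₀) (hρbar : ρ₀ ≤ ρbar)
    {w : (Fin d → ℤ) → ℂ} {Λ : Finset (Fin d → ℤ)} (hL : (Λ.card : ℝ) ≤ L)
    (hsmall : L ^ 2 * (Real.exp (-ρ₀ * N / 10) + Real.exp (Real.sqrt N - 2 * ρ * N / 5)) ≤ 1 / 2)
    (hcov : ∀ k ∈ Λ, ∃ W ⊆ Λ, k ∈ W ∧ (∀ m ∈ Λ \ W, N / 2 ≤ ‖k - m‖) ∧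
      ∃ g : (Fin d → ℤ) → ℂ, (∀ n, ‖g n‖ ≤ Real.exp (Real.sqrt N)) ∧
        (∀ n, N / 10 ≤ ‖k - n‖ → ‖g n‖ ≤ Real.exp (-ρbar * ‖k - n‖)) ∧
        ∀ n' ∈ W, ∑ n ∈ W, g n * opEntry S lam E w n n' = if k = n' then 1 else 0) :
    IsUnit (opMatrix S lam E w Λ) ∧
      ∀ i, ∑ j, ‖(opMatrix S lam E w Λ)⁻¹ i j‖ ≤ 2 * (L * Real.exp (Real.sqrt N)) := by
  choose! W hWΛ hkW hdist g hg1 hg2 hg3 using hcov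
  have hL0 : 0 ≤ L := (Nat.cast_nonneg _).trans hL
  set τ := Real.exp (-ρ₀ * N / 10) + Real.exp (Real.sqrt N - 2 * ρ * N / 5) with hτ
  -- Row `k` of the approximate inverse is row `k` of the Green's function of the region `W k`. The
  -- product with the operator is exact on columns in `W k`; the error lives on columns outside.
  set P : Matrix Λ Λ ℂ := Matrix.of fun k n => if n.1 ∈ W k.1 then g k.1 n.1 else 0 with hP
  have hPA : ∀ k n' : Λ, (P * opMatrix S lam E w Λ) k n' =
      ∑ n ∈ W k.1, g k.1 n * opEntry S lam E w n n'.1 := by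
    intro k n'
    rw [Matrix.mul_apply]
    simp only [hP, opMatrix, Matrix.of_apply]
    rw [Finset.sum_coe_sort Λ
      (fun n => (if n ∈ W k.1 then g k.1 n else 0) * opEntry S lam E w n n'.1)]
    simp only [ite_mul, zero_mul]
    rw [← Finset.sum_filter, Finset.filter_mem_eq_inter,
      Finset.inter_eq_right.2 (hWΛ k.1 k.2)]
  have hcardW : ∀ k ∈ Λ, ((W k).card : ℝ) ≤ L := fun k hk =>
    le_trans (by exact_mod_cast Finset.card_le_card (hWΛ k hk)) hL
  refine isUnit_of_approx_inverse (P := P) (K := P * opMatrix S lam E w Λ - 1) (by positivity)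
    (by abel) (fun k => ?_) (fun k => ?_)
  · have hent : ∀ n' : Λ, ‖(P * opMatrix S lam E w Λ - 1) k n'‖ ≤ L * τ := by
      intro n'
      rw [Matrix.sub_apply, hPA]
      by_cases hn' : n'.1 ∈ W k.1
      · rw [hg3 k.1 k.2 _ hn', Matrix.one_apply]
        simp only [Subtype.ext_iff, sub_self, norm_zero]
        positivity
      · have hne : k ≠ n' := by
          rintro rfl
          exact hn' (hkW k.1 k.2)
        rw [Matrix.one_apply_ne hne, sub_zero]
        refine (norm_sum_le _ _).trans ?_
        refine (Finset.sum_le_card_nsmul _ _ τ (fun n hn => ?_)).trans ?_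
        · have hnn' : n ≠ n'.1 := by
            rintro rfl
            exact hn' hn
          rw [norm_mul]
          have hop := norm_opEntry_off_le (E := E) (w := w) hS hlam hnn'
          have hd := hdist k.1 k.2 n'.1 (Finset.mem_sdiff.2 ⟨n'.2, hn'⟩)
          -- As `n'` is at distance at least `N/2` from `k`, either the Green's function has
          -- decayed, or `n` is at distance at least `2N/5` from `n'` and the hopping decay beats
          -- `e^{√N}`.
          by_cases hfar : N / 10 ≤ ‖k.1 - n‖
          · have h1 := hg2 k.1 k.2 n hfar
            have h2 : Real.exp (-ρbar * ‖k.1 - n‖) ≤ Real.exp (-ρ₀ * N / 10) := by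
              apply Real.exp_le_exp.2
              nlinarith
            have h3 : Real.exp (-ρ * ‖n - n'.1‖) ≤ 1 := by
              rw [Real.exp_le_one_iff]
              nlinarith [norm_nonneg (n - n'.1)]
            calc ‖g k.1 n‖ * ‖opEntry S lam E w n n'.1‖
                ≤ Real.exp (-ρ₀ * N / 10) * 1 :=
                  mul_le_mul (h1.trans h2) (hop.trans h3) (norm_nonneg _) (Real.exp_pos _).le
              _ ≤ τ := by
                rw [mul_one, hτ]
                linarith [Real.exp_pos (Real.sqrt N - 2 * ρ * N / 5)]
          · push Not at hfar
            have htri : ‖k.1 - n'.1‖ ≤ ‖k.1 - n‖ + ‖n - n'.1‖ := norm_sub_le_norm_sub_add_norm_sub ..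
            have h2 : Real.exp (-ρ * ‖n - n'.1‖) ≤ Real.exp (-ρ * (2 * N / 5)) := by
              apply Real.exp_le_exp.2
              nlinarith
            calc ‖g k.1 n‖ * ‖opEntry S lam E w n n'.1‖
                ≤ Real.exp (Real.sqrt N) * Real.exp (-ρ * (2 * N / 5)) :=
                  mul_le_mul (hg1 k.1 k.2 n) (hop.trans h2) (norm_nonneg _) (Real.exp_pos _).le
              _ = Real.exp (Real.sqrt N - 2 * ρ * N / 5) := by
                rw [← Real.exp_add]
                ring_nf
              _ ≤ τ := by
                rw [hτ]
                linarith [Real.exp_pos (-ρ₀ * N / 10)]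
        · rw [nsmul_eq_mul]
          gcongr
          exact hcardW k.1 k.2
    calc ∑ n' : Λ, ‖(P * opMatrix S lam E w Λ - 1) k n'‖
        ≤ (Finset.univ : Finset Λ).card • (L * τ) :=
          Finset.sum_le_card_nsmul _ _ _ (fun n' _ => hent n')
      _ ≤ L * (L * τ) := by
          rw [nsmul_eq_mul, Finset.card_univ, Fintype.card_coe]
          gcongr
      _ = L ^ 2 * τ := by ring
      _ ≤ 1 / 2 := hsmall
  · calc ∑ n : Λ, ‖P k n‖ ≤ (Finset.univ : Finset Λ).card • Real.exp (Real.sqrt N) := by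
          refine Finset.sum_le_card_nsmul _ _ _ (fun n _ => ?_)
          simp only [hP, Matrix.of_apply]
          split_ifs
          · exact hg1 k.1 k.2 n.1
          · rw [norm_zero]
            exact (Real.exp_pos _).le
      _ ≤ L * Real.exp (Real.sqrt N) := by
          rw [nsmul_eq_mul, Finset.card_univ, Fintype.card_coe]
          gcongr

/-- Far from the spectrum the restricted operator is invertible. -/
theorem isUnit_of_large_energy (hS : IsHopping ρ S) (hρ : 0 < ρ) (hlam : 1 < lam) {E C L : ℝ}
    (hC : 0 ≤ C) {w : (Fin d → ℤ) → ℂ} (hw : ∀ n, ‖w n‖ ≤ C) {Λ : Finset (Fin d → ℤ)}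
    (hL : (Λ.card : ℝ) ≤ L) (hE : 2 * (L * (1 + C)) + 1 ≤ |E|) :
    IsUnit (opMatrix S lam E w Λ) ∧ ∀ i, ∑ j, ‖(opMatrix S lam E w Λ)⁻¹ i j‖ ≤ 2 := by
  have hL0 : 0 ≤ L := (Nat.cast_nonneg _).trans hL
  have hE0 : 1 ≤ |E| := by
    have : 0 ≤ L * (1 + C) := by positivity
    linarith
  have hE1 : (E : ℂ) ≠ 0 := by
    rw [ne_eq, Complex.ofReal_eq_zero, ← abs_eq_zero]
    linarith
  have hEn : ‖(E : ℂ)‖ = |E| := by rw [Complex.norm_real, Real.norm_eq_abs]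
  have h := isUnit_of_approx_inverse (A := opMatrix S lam E w Λ)
    (P := Matrix.diagonal fun _ => -(E : ℂ)⁻¹) (K := -(E : ℂ)⁻¹ • opMatrix S lam 0 w Λ) (p := 1) one_pos.le ?_ ?_ ?_
  · simpa using h
  · ext n n'
    simp only [Matrix.diagonal_mul, Matrix.add_apply, Matrix.one_apply, Matrix.smul_apply, opMatrix,
      opEntry, Matrix.of_apply, Subtype.ext_iff, smul_eq_mul]
    split_ifs
    · push_cast
      field_simp
      ring
    · ring
  · intro n
    have hent : ∀ n' : Λ, ‖(-(E : ℂ)⁻¹ • opMatrix S lam 0 w Λ) n n'‖ ≤ |E|⁻¹ * (1 + C) := by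
      intro n'
      rw [Matrix.smul_apply, smul_eq_mul, norm_mul, norm_neg, norm_inv, hEn]
      gcongr
      have := norm_opEntry_le (E := 0) (n' := n'.1) hS hρ hlam (hw n.1)
      rwa [abs_zero, add_zero] at this
    refine (Finset.sum_le_card_nsmul _ _ _ (fun n' _ => hent n')).trans ?_
    rw [nsmul_eq_mul, Finset.card_univ, Fintype.card_coe]
    calc (Λ.card : ℝ) * (|E|⁻¹ * (1 + C)) ≤ L * (|E|⁻¹ * (1 + C)) := by gcongr
      _ = (L * (1 + C)) / |E| := by ring
      _ ≤ 1 / 2 := by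
        rw [div_le_iff₀ (by linarith)]
        linarith
  · intro n
    rw [Finset.sum_eq_single n (fun j _ hj => by rw [Matrix.diagonal_apply_ne _ hj.symm, norm_zero])
      (fun h => absurd (Finset.mem_univ _) h), Matrix.diagonal_apply_eq, norm_neg, norm_inv, hEn]
    exact inv_le_one_of_one_le₀ hE0

theorem opMatrix_add_diagonal (E : ℝ) (w w' : (Fin d → ℤ) → ℂ) (Λ : Finset (Fin d → ℤ)) :
    opMatrix S lam E w' Λ =
      opMatrix S lam E w Λ + Matrix.diagonal (fun n : Λ => w' n.1 - w n.1) := by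
  ext n n'
  simp only [opMatrix, opEntry, Matrix.add_apply, Matrix.of_apply, Matrix.diagonal_apply,
    Subtype.ext_iff]
  split_ifs
  · ring
  · ring

/-- The decomposition of a finite set into a subset and its complement. -/
noncomputable def splitEquiv {α : Type*} [DecidableEq α] {V Λ : Finset α} (h : V ⊆ Λ) :
    ↥(Λ \ V) ⊕ ↥V ≃ ↥Λ :=
  Equiv.ofBijective
    (Sum.elim (fun n => ⟨n.1, (Finset.mem_sdiff.1 n.2).1⟩) (fun n => ⟨n.1, h n.2⟩)) (by
      constructor
      · rintro (a | a) (a' | a') haa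
        · have : a.1 = a'.1 := congrArg (fun z : ↥Λ => z.1) haa
          exact congrArg Sum.inl (Subtype.ext this)
        · have : a.1 = a'.1 := congrArg (fun z : ↥Λ => z.1) haa
          exact absurd (this ▸ a'.2) (Finset.mem_sdiff.1 a.2).2
        · have : a.1 = a'.1 := congrArg (fun z : ↥Λ => z.1) haa
          exact absurd (this ▸ a.2) (Finset.mem_sdiff.1 a'.2).2
        · have : a.1 = a'.1 := congrArg (fun z : ↥Λ => z.1) haa
          exact congrArg Sum.inr (Subtype.ext this)
      · rintro ⟨n, hn⟩
        by_cases hV : n ∈ V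
        · exact ⟨Sum.inr ⟨n, hV⟩, rfl⟩
        · exact ⟨Sum.inl ⟨n, Finset.mem_sdiff.2 ⟨hn, hV⟩⟩, rfl⟩)

theorem opMatrix_toBlocks₁₁ (E : ℝ) (w : (Fin d → ℤ) → ℂ) {V Λ : Finset (Fin d → ℤ)} (h : V ⊆ Λ) :
    ((opMatrix S lam E w Λ).submatrix (splitEquiv h) (splitEquiv h)).toBlocks₁₁ =
      opMatrix S lam E w (Λ \ V) := rfl

end Operator

/-! ### Measure estimates -/

/-- Integration in polar coordinates: a set in the unit ball whose intersections with all rays are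
small is small. -/
theorem volume_le_of_rays {J : ℕ} (hJ : 1 ≤ J) {A : Set (Fin J → ℝ)} (hA : MeasurableSet A)
    (hA1 : ∀ y ∈ A, ‖y‖ ≤ 1) {η : ℝ≥0∞}
    (hray : ∀ θ : Fin J → ℝ, ‖θ‖ = 1 → volume {t : ℝ | 0 < t ∧ t • θ ∈ A} ≤ η) :
    volume A ≤ J * 2 ^ J * η := by
  have : Nonempty (Fin J) := ⟨⟨0, hJ⟩⟩
  set μ : Measure (Fin J → ℝ) := volume with hμ
  set e := homeomorphUnitSphereProd (Fin J → ℝ) with he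
  have hmp := μ.measurePreserving_homeomorphUnitSphereProd
  set A' : Set ({0}ᶜ : Set (Fin J → ℝ)) := Subtype.val ⁻¹' A with hA'
  have hA'm : MeasurableSet A' := hA.preimage measurable_subtype_coe
  set B := e.symm ⁻¹' A' with hB
  have hBm : MeasurableSet B := hA'm.preimage e.symm.continuous.measurable
  have hpre : e ⁻¹' B = A' := by
    ext z
    simp [hB]
  have h1 : μ A = μ.comap Subtype.val A' := by
    rw [comap_subtype_coe_apply (measurableSet_singleton _).compl, hA',
      Subtype.image_preimage_coe, Set.inter_comm, ← Set.sdiff_eq, measure_sdiff_null (measure_singleton _)]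
  have h2 : μ.comap Subtype.val A' =
      (μ.toSphere.prod (Measure.volumeIoiPow (Module.finrank ℝ (Fin J → ℝ) - 1))) B := by
    rw [← hmp.measure_preimage hBm.nullMeasurableSet, ← he, hpre]
  have hslice : ∀ θ : Metric.sphere (0 : Fin J → ℝ) 1,
      Measure.volumeIoiPow (Module.finrank ℝ (Fin J → ℝ) - 1) (Prod.mk θ ⁻¹' B) ≤ η := by
    intro θ
    have hmem : ∀ t : Set.Ioi (0 : ℝ), t ∈ Prod.mk θ ⁻¹' B ↔ t.1 • θ.1 ∈ A := by
      intro t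
      simp [hB, hA', he, homeomorphUnitSphereProd]
    have hsm : MeasurableSet (Prod.mk θ ⁻¹' B) := measurable_prodMk_left hBm
    have hθ : ‖θ.1‖ = 1 := by simp
    rw [Measure.volumeIoiPow, withDensity_apply _ hsm]
    calc ∫⁻ a in Prod.mk θ ⁻¹' B, ENNReal.ofReal (a.1 ^ (Module.finrank ℝ (Fin J → ℝ) - 1))
          ∂(Measure.comap Subtype.val volume)
        -- In the unit ball the radial density `t^{J-1}` is at most `1`.
        ≤ ∫⁻ a in Prod.mk θ ⁻¹' B, 1 ∂(Measure.comap Subtype.val volume) := by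
          refine setLIntegral_mono' hsm (fun t ht => ?_)
          rw [ENNReal.ofReal_le_one]
          have := hA1 _ ((hmem t).1 ht)
          rw [norm_smul, hθ, mul_one, Real.norm_eq_abs, abs_of_pos t.2] at this
          exact pow_le_one₀ t.2.out.le this
      _ = volume (Subtype.val '' (Prod.mk θ ⁻¹' B)) := by
          rw [setLIntegral_one, comap_subtype_coe_apply measurableSet_Ioi]
      _ ≤ volume {t : ℝ | 0 < t ∧ t • θ.1 ∈ A} := by
          refine measure_mono ?_
          rintro _ ⟨t, ht, rfl⟩
          exact ⟨t.2, (hmem t).1 ht⟩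
      _ ≤ η := hray θ.1 hθ
  calc μ A = ∫⁻ θ, Measure.volumeIoiPow (Module.finrank ℝ (Fin J → ℝ) - 1) (Prod.mk θ ⁻¹' B)
        ∂μ.toSphere := by rw [h1, h2, Measure.prod_apply hBm]
    _ ≤ ∫⁻ _, η ∂μ.toSphere := lintegral_mono hslice
    _ = η * (J * μ (Metric.ball 0 1)) := by
        rw [lintegral_const, μ.toSphere_apply_univ, Module.finrank_fin_fun]
    _ ≤ J * 2 ^ J * η := by
        rw [mul_comm]
        gcongr
        -- The norm is the maximum norm, so the unit ball has volume `2^J`.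
        rw [hμ, Real.volume_pi_ball _ one_pos]
        simp

/-- If a set near `y₀` is contained in the set where a function, holomorphic along all lines
through `y₀` and not small at `y₀`, is very small, then it has small measure. -/
theorem volume_le_of_lines {J : ℕ} (hJ : 1 ≤ J) {A : Set (Fin J → ℝ)} (hA : MeasurableSet A)
    {y₀ : Fin J → ℝ} {a B ε μ h : ℝ} (ha : 0 < a) (ha1 : a ≤ 1) (hAa : ∀ y ∈ A, ‖y - y₀‖ ≤ a)
    (hh : 0 < h) (n : ℕ)
    (hlines : ∀ θ : Fin J → ℝ, ‖θ‖ = 1 → ∃ (f : ℂ → ℂ) (U : Set ℂ), IsOpen U ∧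
      Metric.closedBall 0 (9 * a) ⊆ U ∧ DifferentiableOn ℂ f U ∧ (∀ z, ‖z‖ = 9 * a → ‖f z‖ ≤ B) ∧
      μ ≤ ‖f 0‖ ∧ ∀ t : ℝ, 0 < t → t ≤ a → y₀ + t • θ ∈ A → ‖f t‖ ≤ ε)
    (hnum : B * (1 / 4) ^ (n + 1) + 2 * ((n + 1) * (ε * (18 * a / h) ^ n)) < μ) :
    volume A ≤ J * 2 ^ J * ENNReal.ofReal (2 * n * h) := by
  set A' : Set (Fin J → ℝ) := (fun y => y₀ + y) ⁻¹' A with hA'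
  have hvol : volume A' = volume A := measure_preimage_add volume y₀ A
  have hA'a : ∀ y ∈ A', ‖y‖ ≤ a := fun y hy => by simpa using hAa _ hy
  rw [← hvol]
  refine volume_le_of_rays hJ (hA.preimage (measurable_const_add y₀))
    (fun y hy => (hA'a y hy).trans ha1) (fun θ hθ => ?_)
  obtain ⟨f, U, hU, hsub, hf, hB, hμ, hε⟩ := hlines θ hθ
  by_contra hcon
  push Not at hcon
  have hta : ∀ t ∈ {t : ℝ | 0 < t ∧ t • θ ∈ A'}, t ≤ a := by
    rintro t ⟨ht0, ht⟩
    have := hA'a _ ht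
    rwa [norm_smul, hθ, mul_one, Real.norm_eq_abs, abs_of_pos ht0] at this
  have := norm_zero_le_of_small_on hU ha hsub hf hB hh n
    (F := {t : ℝ | 0 < t ∧ t • θ ∈ A'}) (ε := ε)
    (fun t ht => by rw [abs_of_pos ht.1]; exact hta t ht)
    (fun t ht => hε t ht.1 (hta t ht) ht.2) hcon
  linarith

/-- Lifting a subset of the torus to a unit cube does not increase its measure. -/
theorem volume_lift_le {J : ℕ} (a : Fin J → ℝ) (c : Fin J → UnitAddCircle)
    (Θ : Set (Fin J → UnitAddCircle)) :
    volume {y : Fin J → ℝ | (∀ i, y i ∈ Set.Ioc (a i) (a i + 1)) ∧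
      (fun i => (y i : UnitAddCircle)) + c ∈ Θ} ≤ volume Θ := by
  have hmp := measurePreserving_pi (fun i => (volume : Measure ℝ).restrict (Set.Ioc (a i) (a i + 1)))
    (fun _ => (volume : Measure UnitAddCircle)) (fun i => UnitAddCircle.measurePreserving_mk (a i))
  rw [← Measure.restrict_pi_pi] at hmp
  set Θ' : Set (Fin J → UnitAddCircle) := (fun θ => θ + c) ⁻¹' Θ with hΘ'
  have h1 : volume Θ' = volume Θ := measure_preimage_add_right volume c Θ
  -- Only this inequality is available, since `Θ` need not be measurable.
  have h2 := Measure.le_map_apply hmp.aemeasurable Θ'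
  rw [hmp.map_eq] at h2
  rw [← h1]
  refine le_trans ?_ h2
  refine le_trans ?_ (Measure.le_restrict_apply _ _)
  refine measure_mono ?_
  rintro y ⟨hy1, hy2⟩
  exact ⟨hy2, fun i _ => hy1 i⟩

/-- A small closed cube contains a point outside of finitely many sets whose measure is small. -/
theorem exists_mem_closedBall_notMem {J : ℕ} {ι : Type*} {x : Fin J → ℝ} {δ β : ℝ} (hδ : 0 < δ)
    (hδ1 : δ < 1 / 2) (hβ : 0 ≤ β) (Λ : Finset ι) (Θ : ι → Set (Fin J → UnitAddCircle))
    (c : ι → Fin J → UnitAddCircle)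
    (hΘ : ∀ n ∈ Λ, volume (Θ n) ≤ ENNReal.ofReal β) (hnum : Λ.card * β < (2 * δ) ^ J) :
    ∃ y : Fin J → ℝ, ‖y - x‖ ≤ δ ∧
      ∀ n ∈ Λ, (fun i => (y i : UnitAddCircle)) + c n ∉ Θ n := by
  by_contra hcon
  push Not at hcon
  have hsub : Metric.closedBall x δ ⊆ ⋃ n ∈ Λ, {y : Fin J → ℝ |
      (∀ i, y i ∈ Set.Ioc (x i - 1 / 2) (x i - 1 / 2 + 1)) ∧
      (fun i => (y i : UnitAddCircle)) + c n ∈ Θ n} := by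
    intro y hy
    rw [Metric.mem_closedBall, dist_eq_norm] at hy
    obtain ⟨n, hn, hyn⟩ := hcon y hy
    refine Set.mem_iUnion₂.2 ⟨n, hn, fun i => ?_, hyn⟩
    have h1 := (norm_le_pi_norm (y - x) i).trans hy
    rw [Pi.sub_apply, Real.norm_eq_abs, abs_le] at h1
    constructor <;> linarith
  have h1 := (measure_mono (μ := volume) hsub).trans (measure_biUnion_finset_le Λ _)
  have h2 : volume (Metric.closedBall x δ) ≤ ENNReal.ofReal (Λ.card * β) := by
    refine h1.trans ((Finset.sum_le_card_nsmul _ _ (ENNReal.ofReal β) (fun n hn => ?_)).trans ?_)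
    · exact (volume_lift_le _ _ _).trans (hΘ n hn)
    · rw [nsmul_eq_mul, ← ENNReal.ofReal_natCast, ← ENNReal.ofReal_mul (by positivity)]
  rw [Real.volume_pi_closedBall _ hδ.le, Fintype.card_fin,
    ENNReal.ofReal_le_ofReal_iff (by positivity)] at h2
  linarith

/-! ### The reduced determinant -/

section Reduced

variable {d : ℕ} {S : Matrix (Fin d → ℤ) (Fin d → ℤ) ℂ} {lam ρ E q C : ℝ} {w : (Fin d → ℤ) → ℂ}
  {V Λ : Finset (Fin d → ℤ)}

/-- The determinant of the Schur complement of `Λ \ V` in `Λ`. -/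
noncomputable def reducedDet (S : Matrix (Fin d → ℤ) (Fin d → ℤ) ℂ) (lam E : ℝ)
    (w : (Fin d → ℤ) → ℂ) (V Λ : Finset (Fin d → ℤ)) : ℂ :=
  (opMatrix S lam E w Λ).det / (opMatrix S lam E w (Λ \ V)).det

/-- The three inputs of the Cartan argument: an upper bound for the holomorphic function, a lower
bound wherever the full inverse is controlled, and the passage from a large inverse to a small
reduced determinant. All exponents are `V.card`, independent of the size of `Λ`. -/
theorem norm_reducedDet_bounds (hS : IsHopping ρ S) (hρ : 0 < ρ) (hlam : 1 < lam) (hV : V ⊆ Λ)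
    (hw : ∀ n, ‖w n‖ ≤ C) (hq : 1 + C + |E| ≤ q) (hΛ : (Λ.card : ℝ) ≤ q)
    (hA : IsUnit (opMatrix S lam E w (Λ \ V)))
    (hAi : ∀ i, ∑ j, ‖(opMatrix S lam E w (Λ \ V))⁻¹ i j‖ ≤ q) :
    ‖reducedDet S lam E w V Λ‖ ≤ (2 * q ^ 6) ^ V.card ∧
      (IsUnit (opMatrix S lam E w Λ) →
        ((∀ i, ∑ j, ‖(opMatrix S lam E w Λ)⁻¹ i j‖ ≤ q) →
          1 ≤ ‖reducedDet S lam E w V Λ‖ * (q ^ 2) ^ V.card) ∧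
        ∀ i j, ‖(opMatrix S lam E w Λ)⁻¹ i j‖ * ‖reducedDet S lam E w V Λ‖ ≤
          2 * q ^ 8 * (2 * q ^ 6) ^ V.card) := by
  have hC : 0 ≤ C := (norm_nonneg _).trans (hw 0)
  have hq1 : 1 ≤ q := by
    have := abs_nonneg E
    linarith
  set e := splitEquiv hV with he
  set T := (opMatrix S lam E w Λ).submatrix e e with hT
  have hblock : T.toBlocks₁₁ = opMatrix S lam E w (Λ \ V) := opMatrix_toBlocks₁₁ E w hV
  have hcard : Fintype.card V = V.card := Fintype.card_coe _
  have hm : (Fintype.card ↥(Λ \ V) : ℝ) ≤ q := by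
    rw [Fintype.card_coe]
    exact le_trans (by exact_mod_cast Finset.card_le_card Finset.sdiff_subset) hΛ
  have hn : (Fintype.card V : ℝ) ≤ q := by
    rw [Fintype.card_coe]
    exact le_trans (by exact_mod_cast Finset.card_le_card hV) hΛ
  have hdet : reducedDet S lam E w V Λ = T.det / T.toBlocks₁₁.det := by
    rw [hblock, hT, Matrix.det_submatrix_equiv_self, reducedDet]
  have hTq : ∀ i j, ‖T i j‖ ≤ q := fun i j => (norm_opEntry_le hS hρ hlam (hw _)).trans hq
  have hrow : ∀ {ι : Type} [Fintype ι] {X : Matrix ι ι ℂ}, (∀ i, ∑ j, ‖X i j‖ ≤ q) →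
      ∀ i j, ‖X i j‖ ≤ q := fun h i j =>
    (Finset.single_le_sum (f := fun j => ‖_‖) (fun _ _ => norm_nonneg _)
      (Finset.mem_univ j)).trans (h i)
  rw [← hblock] at hA hAi
  have hAi' := hrow hAi
  rw [hdet, ← hcard]
  refine ⟨norm_det_div_le hA hq1 hm hn hTq hAi', fun hu => ?_⟩
  have hTu : IsUnit T := by
    rw [Matrix.isUnit_iff_isUnit_det, hT, Matrix.det_submatrix_equiv_self,
      ← Matrix.isUnit_iff_isUnit_det]
    exact hu
  have hTinv : T⁻¹ = (opMatrix S lam E w Λ)⁻¹.submatrix e e := by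
    rw [hT, Matrix.inv_submatrix_equiv]
  refine ⟨fun hi => one_le_norm_det_div hA hTu hq1 hn (fun i j => ?_), fun i j => ?_⟩
  · rw [hTinv]
    exact hrow hi _ _
  · have := norm_inv_mul_norm_det_div_le hA hTu hq1 hm hn hTq hAi' (e.symm i) (e.symm j)
    rw [hTinv] at this
    simpa using this

end Reduced

/-! ### Lines in phase space and the matrix-valued Cartan estimate. -/

theorem continuous_of_isAnalyticOnTorus {d : ℕ} {b : Fin d → ℕ} {v : Torus b → ℝ}
    (hv : IsAnalyticOnTorus v) : Continuous fun x : Vec b => v (toTorus x) :=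
  continuous_iff_continuousAt.2 fun x => (hv x).continuousAt

/-- Extend along the normalized direction from `p` to `p'`, and use the Lipschitz bound at the
center. -/
theorem ExtendsAlong.abs_sub_le {V : Type*} [NormedAddCommGroup V] [NormedSpace ℝ V]
    {F : V → ℝ} {r C : ℝ} (h : ∀ p θ : V, ‖θ‖ ≤ 1 → ExtendsAlong F r C p θ) {p p' : V}
    (hpp : ‖p' - p‖ < r) : |F p' - F p| ≤ C * ‖p' - p‖ := by
  rcases eq_or_ne p' p with rfl | hne
  · simp
  have hpos : 0 < ‖p' - p‖ := norm_pos_iff.2 (sub_ne_zero.2 hne)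
  obtain ⟨g, _, h2, h3⟩ := h p (‖p' - p‖⁻¹ • (p' - p)) (by
    rw [norm_smul, norm_inv, norm_norm, inv_mul_cancel₀ hpos.ne'])
  have e1 := h3 ‖p' - p‖ (by rwa [abs_of_pos hpos])
  rw [smul_smul, mul_inv_cancel₀ hpos.ne', one_smul, add_sub_cancel] at e1
  have e0 := h3 0 (by rw [abs_zero]; exact hpos.trans hpp)
  rw [zero_smul, add_zero, Complex.ofReal_zero] at e0
  have := (h2 ‖p' - p‖ (by simpa using hpp)).2
  rw [e1, e0, ← Complex.ofReal_sub, Complex.norm_real] at this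
  simpa using this

theorem ExtendsAlong.abs_le {V : Type*} [NormedAddCommGroup V] [NormedSpace ℝ V]
    {F : V → ℝ} {r C : ℝ} (hr : 0 < r) {p θ : V} (h : ExtendsAlong F r C p θ) : |F p| ≤ C := by
  obtain ⟨g, _, h2, h3⟩ := h
  have e0 := h3 0 (by rwa [abs_zero])
  rw [zero_smul, add_zero, Complex.ofReal_zero] at e0
  have := (h2 0 (by rwa [norm_zero])).1
  rw [e0, Complex.norm_real] at this
  simpa using this

section Line

variable {d : ℕ} {b : Fin d → ℕ}

/-- The lattice translate `x + n ω` in `ℝ^b`. -/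
def liftShift (x : Vec b) (ω : Vec b) (n : Fin d → ℤ) : Vec b := x + fun i => (n i : ℝ) • ω i

theorem shift_toTorus (x ω : Vec b) (n : Fin d → ℤ) :
    shift (toTorus x) ω n = toTorus (liftShift x ω n) := by
  rw [shift, liftShift, toTorus_add]

/-- Moving the block `j` along `θ` moves every lattice translate by the same vector, without a
factor depending on `n`. All diagonal entries thus extend holomorphically in one variable to a
common disc. -/
theorem liftShift_update_add (x ω : Vec b) (j : Fin d) (y θ : Fin (b j) → ℝ) (n : Fin d → ℤ)
    (t : ℝ) : liftShift (Function.update x j (y + t • θ)) ω n =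
      liftShift (Function.update x j y) ω n + t • (Pi.single j θ : Vec b) := by
  funext i
  by_cases hi : i = j
  · subst hi
    simp [liftShift]
    abel
  · simp [liftShift, hi]

theorem norm_liftShift_update_sub (x ω : Vec b) (j : Fin d) (y y' : Fin (b j) → ℝ)
    (n : Fin d → ℤ) :
    ‖liftShift (Function.update x j y) ω n - liftShift (Function.update x j y') ω n‖ =
      ‖y - y'‖ := by
  have := liftShift_update_add x ω j y' (y - y') n 1
  rw [one_smul, add_sub_cancel] at this
  rw [this, add_sub_cancel_left, one_smul, Pi.norm_single]

end Line

/-- The matrix-valued Cartan estimate: if the Green's function of `Λ \ V` is controlled at the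
center of a small cube, and the Green's function of `Λ` is controlled at some point of this cube,
then the Green's function of `Λ` is large only on a small set. -/
theorem volume_greenNorm_large_le {d : ℕ} {b : Fin d → ℕ}
    {S : Matrix (Fin d → ℤ) (Fin d → ℤ) ℂ} {v : Torus b → ℝ} (hv : IsAnalyticOnTorus v)
    {lam ρ E q C r δ p κ h : ℝ} (hr : 0 < r)
    (hext : ∀ p θ : Vec b, ‖θ‖ ≤ 1 → ExtendsAlong (fun x => v (toTorus x)) r C p θ)
    (hS : IsHopping ρ S) (hρ : 0 < ρ) (hlam : 1 < lam) {ω x : Vec b} {j : Fin d} (hj : 1 ≤ b j)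
    {V Λ : Finset (Fin d → ℤ)} (hV : V ⊆ Λ) (hq : 1 + C + |E| ≤ q) (hΛ : (Λ.card : ℝ) ≤ q)
    (hδ : 0 < δ) (hδ1 : 2 * δ ≤ 1) (hδr : 21 * δ ≤ r) (hp : 0 ≤ p) (hpq : 2 * p ≤ q)
    (hpδ : p * (C * (21 * δ)) ≤ 1 / 2)
    (hA : IsUnit (boxOperator S v lam ω (Λ \ V) E (toTorus x)))
    (hAi : ∀ i, ∑ l, ‖(boxOperator S v lam ω (Λ \ V) E (toTorus x))⁻¹ i l‖ ≤ p)
    {y₀ : Fin (b j) → ℝ} (hy₀ : ‖y₀ - x j‖ ≤ δ)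
    (hT : IsUnit (boxOperator S v lam ω Λ E (toTorus (Function.update x j y₀))))
    (hTi : ∀ i, ∑ l, ‖(boxOperator S v lam ω Λ E (toTorus (Function.update x j y₀)))⁻¹ i l‖ ≤ q)
    (hκ : 0 < κ) (hh : 0 < h) (n : ℕ)
    (hnum : (2 * q ^ 6) ^ V.card * (1 / 4) ^ (n + 1) +
      2 * ((n + 1) * ((2 * q ^ 10 * (2 * q ^ 6) ^ V.card / κ) * (36 * δ / h) ^ n)) <
        ((q ^ 2) ^ V.card)⁻¹) :
    volume {y : Fin (b j) → ℝ | ‖y - x j‖ ≤ δ ∧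
        ENNReal.ofReal κ ≤ greenNorm S v lam ω Λ E (toTorus (Function.update x j y))} ≤
      b j * 2 ^ b j * ENNReal.ofReal (2 * n * h) := by
  have hC : 0 ≤ C := (abs_nonneg _).trans ((hext 0 0 (by simp)).abs_le hr)
  have hq1 : 1 ≤ q := by
    have := abs_nonneg E
    linarith
  -- the real potential
  set u : (Fin (b j) → ℝ) → (Fin d → ℤ) → ℂ := fun y m =>
    ((v (toTorus (liftShift (Function.update x j y) ω m)) : ℝ) : ℂ) with hu
  have hbox : ∀ (y : Fin (b j) → ℝ) (Λ' : Finset (Fin d → ℤ)),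
      boxOperator S v lam ω Λ' E (toTorus (Function.update x j y)) =
        opMatrix S lam E (u y) Λ' := by
    intro y Λ'
    rw [boxOperator_eq_opMatrix hlam]
    simp only [shift_toTorus, hu]
  have huC : ∀ y m, ‖u y m‖ ≤ C := by
    intro y m
    rw [hu, Complex.norm_real, Real.norm_eq_abs]
    exact (hext _ 0 (by simp)).abs_le hr
  have hulip : ∀ y y' m, ‖y - y'‖ < r → ‖u y m - u y' m‖ ≤ C * ‖y - y'‖ := by
    intro y y' m hyy
    rw [hu, ← Complex.ofReal_sub, Complex.norm_real, Real.norm_eq_abs,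
      ← norm_liftShift_update_sub x ω j y y' m]
    exact ExtendsAlong.abs_sub_le hext (by rwa [norm_liftShift_update_sub])
  have hxx : Function.update x j (x j) = x := Function.update_eq_self j x
  rw [← hxx, hbox] at hA hAi
  rw [hbox] at hT hTi
  -- the stability of the Green's function of `Λ \ V`
  have hstab : ∀ w : (Fin d → ℤ) → ℂ, (∀ m, ‖w m - u (x j) m‖ ≤ C * (21 * δ)) →
      IsUnit (opMatrix S lam E w (Λ \ V)) ∧
        ∀ i, ∑ l, ‖(opMatrix S lam E w (Λ \ V))⁻¹ i l‖ ≤ q := by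
    intro w hw
    rw [opMatrix_add_diagonal E (u (x j)) w]
    have := isUnit_add_diagonal hA hp hAi (w := fun m => w m.1 - u (x j) m.1)
      (fun m => hw m.1) hpδ
    exact ⟨this.1, fun i => (this.2 i).trans hpq⟩
  have hureal : ∀ y, ‖y - x j‖ ≤ δ → ∀ m, ‖u y m - u (x j) m‖ ≤ C * (21 * δ) := by
    intro y hy m
    refine (hulip y (x j) m (by linarith)).trans ?_
    gcongr
    linarith
  set ε := 2 * q ^ 10 * (2 * q ^ 6) ^ V.card / κ with hε
  -- Smallness of the reduced determinant, written without division: this set is closed, hence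
  -- measurable, and contains the set to be estimated.
  set A : Set (Fin (b j) → ℝ) := {y | ‖y - x j‖ ≤ δ ∧
    ‖(opMatrix S lam E (u y) Λ).det‖ ≤ ε * ‖(opMatrix S lam E (u y) (Λ \ V)).det‖} with hAdef
  have hcont : ∀ Λ' : Finset (Fin d → ℤ), Continuous fun y => (opMatrix S lam E (u y) Λ').det := by
    intro Λ'
    refine Continuous.matrix_det (continuous_matrix fun m m' => ?_)
    simp only [opMatrix, opEntry, Matrix.of_apply]
    have hum : Continuous fun y => u y m.1 := by
      have hup : Continuous fun y : Fin (b j) → ℝ => (Function.update x j y : Vec b) :=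
        continuous_const.update j continuous_id
      exact Complex.continuous_ofReal.comp
        ((continuous_of_isAnalyticOnTorus hv).comp (hup.add continuous_const))
    split_ifs
    · fun_prop
    · fun_prop
  have hAmeas : MeasurableSet A := by
    have hball : IsClosed {y : Fin (b j) → ℝ | ‖y - x j‖ ≤ δ} :=
      isClosed_le (by fun_prop) continuous_const
    exact IsClosed.measurableSet (hball.inter <| isClosed_le (hcont Λ).norm (continuous_const.mul (hcont (Λ \ V)).norm))
  have hsub : {y : Fin (b j) → ℝ | ‖y - x j‖ ≤ δ ∧
      ENNReal.ofReal κ ≤ greenNorm S v lam ω Λ E (toTorus (Function.update x j y))} ⊆ A := by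
    rintro y ⟨hy, hyκ⟩
    refine ⟨hy, ?_⟩
    obtain ⟨hAu, hAq⟩ := hstab (u y) (hureal y hy)
    have hdA : 0 < ‖(opMatrix S lam E (u y) (Λ \ V)).det‖ :=
      norm_pos_iff.2 ((Matrix.isUnit_iff_isUnit_det _).1 hAu).ne_zero
    rw [← div_le_iff₀ hdA, ← norm_div]
    change ‖reducedDet S lam E (u y) V Λ‖ ≤ ε
    have hbd := (norm_reducedDet_bounds hS hρ hlam hV (huC y) hq hΛ hAu hAq).2
    by_cases hTu : IsUnit (opMatrix S lam E (u y) Λ)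
    · rw [greenNorm, green, hbox, if_pos hTu, ENNReal.ofReal_le_ofReal_iff (norm_nonneg _)] at hyκ
      rcases (norm_nonneg (reducedDet S lam E (u y) V Λ)).eq_or_lt with h0 | h0
      · rw [← h0, hε]
        positivity
      · have h1 := toEuclideanCLM_norm_le (G := (opMatrix S lam E (u y) Λ)⁻¹)
          (g := 2 * q ^ 8 * (2 * q ^ 6) ^ V.card / ‖reducedDet S lam E (u y) V Λ‖) (by positivity)
          (fun i l => by
            rw [le_div_iff₀ h0]
            exact (hbd hTu).2 i l)
        rw [Fintype.card_coe] at h1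
        have h2 : κ ≤ q ^ 2 * (2 * q ^ 8 * (2 * q ^ 6) ^ V.card /
            ‖reducedDet S lam E (u y) V Λ‖) := by
          refine hyκ.trans (h1.trans ?_)
          gcongr
        rw [mul_div_assoc', le_div_iff₀ h0] at h2
        rw [hε, le_div_iff₀ hκ]
        linarith
    · have : (opMatrix S lam E (u y) Λ).det = 0 := by
        rwa [Matrix.isUnit_iff_isUnit_det, isUnit_iff_ne_zero, not_not] at hTu
      rw [reducedDet, this, zero_div, norm_zero, hε]
      positivity
  refine (measure_mono hsub).trans ?_
  -- The lines start at `y₀` rather than at `x j`, so the ball is seen within distance `2δ`. The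
  -- circle of radius `9a = 18δ` fits in the disc of radius `20δ`, and the offset of `y₀` accounts
  -- for the total `21δ`.
  refine volume_le_of_lines (a := 2 * δ) (ε := ε) (y₀ := y₀) hj hAmeas (by positivity) hδ1 ?_ hh n ?_
    (by rw [show 18 * (2 * δ) = 36 * δ by ring]; exact hnum)
  · rintro y ⟨hy, _⟩
    have : y - y₀ = (y - x j) - (y₀ - x j) := by abel
    rw [this]
    exact (norm_sub_le _ _).trans (by linarith)
  intro θ hθ
  have hθ' : ‖(Pi.single j θ : Vec b)‖ ≤ 1 := by rw [Pi.norm_single, hθ]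
  choose g hg1 hg2 hg3 using fun m : Fin d → ℤ =>
    hext (liftShift (Function.update x j y₀) ω m) (Pi.single j θ) hθ'
  have hgreal : ∀ t : ℝ, |t| < r → (fun m => g m t) = u (y₀ + t • θ) := by
    intro t ht
    funext m
    rw [hg3 m t ht, hu]
    simp only [liftShift_update_add]
  have hg0 : (fun m => g m 0) = u y₀ := by
    have := hgreal 0 (by rwa [abs_zero])
    simpa using this
  have hz : ∀ z : ℂ, ‖z‖ < 20 * δ → IsUnit (opMatrix S lam E (fun m => g m z) (Λ \ V)) ∧
        ∀ i, ∑ l, ‖(opMatrix S lam E (fun m => g m z) (Λ \ V))⁻¹ i l‖ ≤ q := by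
    intro z hz
    refine hstab _ (fun m => ?_)
    have h1 := (hg2 m z (by linarith)).2
    have h2 := hulip y₀ (x j) m (by linarith)
    rw [← congrFun hg0 m] at h2
    have h3 : g m z - u (x j) m = (g m z - g m 0) + (g m 0 - u (x j) m) := by ring
    rw [h3]
    refine (norm_add_le _ _).trans ((add_le_add h1 h2).trans ?_)
    nlinarith
  refine ⟨fun z => reducedDet S lam E (fun m => g m z) V Λ, Metric.ball 0 (20 * δ),
    Metric.isOpen_ball, Metric.closedBall_subset_ball (by linarith), ?_,
    fun z hzn => ?_, ?_, fun t ht0 hta htA => ?_⟩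
  · have hdiff : ∀ Λ' : Finset (Fin d → ℤ), DifferentiableOn ℂ
        (fun z => (opMatrix S lam E (fun m => g m z) Λ').det) (Metric.ball 0 (20 * δ)) := by
      intro Λ'
      simp only [Matrix.det_apply]
      refine DifferentiableOn.fun_sum fun σ _ => DifferentiableOn.const_smul ?_ _
      refine DifferentiableOn.fun_finsetProd fun i _ => ?_
      simp only [opMatrix, opEntry, Matrix.of_apply]
      have hgd : DifferentiableOn ℂ (g (σ i).1) (Metric.ball 0 (20 * δ)) :=
        (hg1 _).mono (Metric.ball_subset_ball (by linarith))
      split_ifs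
      · exact (differentiableOn_const _).add (hgd.sub (differentiableOn_const _))
      · fun_prop
    refine (hdiff Λ).div (hdiff (Λ \ V)) (fun z hzb => ?_)
    exact ((Matrix.isUnit_iff_isUnit_det _).1 (hz z (by simpa using hzb)).1).ne_zero
  · have hz1 : ‖z‖ < 20 * δ := by linarith
    exact (norm_reducedDet_bounds hS hρ hlam hV (fun m => (hg2 m z (by linarith)).1) hq hΛ
      (hz z hz1).1 (hz z hz1).2).1
  · have hz1 : ‖(0 : ℂ)‖ < 20 * δ := by
      rw [norm_zero]
      positivity
    obtain ⟨h1, h2⟩ := hz 0 hz1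
    simp only [hg0] at h1 h2 ⊢
    rw [inv_le_iff_one_le_mul₀ (by positivity)]
    exact ((norm_reducedDet_bounds hS hρ hlam hV (huC y₀) hq hΛ h1 h2).2 hT).1 hTi
  · dsimp only
    rw [hgreal t (by rw [abs_of_pos ht0]; linarith)]
    have h1 := hstab _ (hureal _ htA.1)
    have hdA : 0 < ‖(opMatrix S lam E (u (y₀ + t • θ)) (Λ \ V)).det‖ :=
      norm_pos_iff.2 ((Matrix.isUnit_iff_isUnit_det _).1 h1.1).ne_zero
    rw [reducedDet, norm_div, div_le_iff₀ hdA]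
    exact htA.2

/-! ### The inductive step at admissible scales -/

/-- The relations between the scales under which the inductive step works; `L` bounds the
cardinality of the large region, `r` and `C` are the constants of the holomorphic extension. -/
structure AdmissibleScales (d J : ℕ) (ρ ρ₀ r C N₁ N₂ N L : ℝ) : Prop where
  one_le : 1 ≤ N₁
  le_mid : N₁ ≤ N₂
  two_mul_le : 2 * N₂ ≤ N
  card_le : (2 * N + 1) ^ d ≤ L
  cover_small : L ^ 2 * (Real.exp (-ρ₀ * N₁ / 10) +
    Real.exp (Real.sqrt N₁ - 2 * ρ * N₁ / 5)) ≤ 1 / 2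
  cover_mid : L ^ 2 * (Real.exp (-ρ₀ * N₂ / 10) +
    Real.exp (Real.sqrt N₂ - 2 * ρ * N₂ / 5)) ≤ 1 / 2
  perturb : 2 * (L * Real.exp (Real.sqrt N₁)) * (C * (21 * Real.exp (-ρ * N₁))) ≤ 1 / 2
  radius_le_one : 36 * Real.exp (-ρ * N₁) ≤ 1
  radius_le : 36 * Real.exp (-ρ * N₁) ≤ r
  measure_lt : L * Real.exp (-N₁ ^ 2) < (2 * Real.exp (-ρ * N₁)) ^ J
  base_le : (4 * C + 5) * (L * Real.exp (Real.sqrt N₂)) ≤ Real.exp N₂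
  energy_lt : 2 * L ^ 2 < Real.exp (Real.sqrt N)
  cartan_le : 45 * ((21 ^ d + 1) * N₂) ≤ N ^ (1 / 40 : ℝ)
  two_le : 2 ≤ N ^ (1 / 24 : ℝ)
  dim_le : 2 * (J * 2 ^ J) ≤ N ^ (5 / 24 : ℝ)

/-- The choice of parameters in the Cartan estimate. -/
theorem cartan_numerics {d M : ℕ} {N₂ N δ : ℝ} (hN₂ : 1 ≤ N₂) (hN : 1 ≤ N) (hδ : 0 < δ)
    (hδ1 : 36 * δ ≤ 1) (hM : (M : ℝ) ≤ 21 ^ d * N ^ (1 / 10 : ℝ))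
    (hc : 45 * ((21 ^ d + 1) * N₂) ≤ N ^ (1 / 40 : ℝ)) :
    ∃ n : ℕ, (n : ℝ) ≤ N ^ (1 / 8 : ℝ) ∧
      (2 * Real.exp N₂ ^ 6) ^ M * (1 / 4) ^ (n + 1) +
        2 * ((n + 1) * ((2 * Real.exp N₂ ^ 10 * (2 * Real.exp N₂ ^ 6) ^ M /
          Real.exp (Real.sqrt N)) * (36 * δ / Real.exp (-N ^ (3 / 8 : ℝ))) ^ n)) <
        ((Real.exp N₂ ^ 2) ^ M)⁻¹ := by
  have hN0 : 0 < N := by linarith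
  -- All competing exponents are multiples of `A`: `7A` for the upper bound, `2A` for the lower
  -- bound, `10A` for `q^10`.
  set A := ((M : ℝ) + 1) * N₂ with hA
  have hA1 : 1 ≤ A := by
    have : (0 : ℝ) ≤ M := Nat.cast_nonneg _
    nlinarith
  have hMA : (M : ℝ) ≤ A := by
    have : (0 : ℝ) ≤ M := Nat.cast_nonneg _
    nlinarith
  have hMN : (M : ℝ) * N₂ ≤ A := by nlinarith
  have hN₂A : N₂ ≤ A := by
    have : (0 : ℝ) ≤ M := Nat.cast_nonneg _
    nlinarith
  have hpow10 : 1 ≤ N ^ (1 / 10 : ℝ) := Real.one_le_rpow hN (by norm_num)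
  have hAN : 45 * A ≤ N ^ (1 / 8 : ℝ) := by
    calc 45 * A ≤ 45 * ((21 ^ d * N ^ (1 / 10 : ℝ) + N ^ (1 / 10 : ℝ)) * N₂) := by
          rw [hA]
          gcongr
      _ = (45 * ((21 ^ d + 1) * N₂)) * N ^ (1 / 10 : ℝ) := by ring
      _ ≤ N ^ (1 / 40 : ℝ) * N ^ (1 / 10 : ℝ) := by gcongr
      _ = N ^ (1 / 8 : ℝ) := by
          rw [← Real.rpow_add hN0]
          norm_num
  -- The gain `4^{-n} ≤ e^{-10A}` beats `e^{7A}` and leaves less than the lower bound `e^{-2A}`.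
  set n := ⌈10 * A⌉₊ with hn
  have hn1 : 10 * A ≤ n := Nat.le_ceil _
  have hn2 : (n : ℝ) ≤ 11 * A := by
    have := Nat.ceil_lt_add_one (a := 10 * A) (by positivity)
    linarith
  refine ⟨n, by linarith, ?_⟩
  set P := N ^ (3 / 8 : ℝ) with hP
  have hP1 : 1 ≤ P := Real.one_le_rpow hN (by norm_num)
  -- The interpolation error needs `4 + 30A + 11AP ≤ √N`; as `A, P ≥ 1`, the constant `45 = 4 + 30 +
  -- 11` is enough.
  have hsqrt : 45 * A * P ≤ Real.sqrt N := by
    calc 45 * A * P ≤ N ^ (1 / 8 : ℝ) * N ^ (3 / 8 : ℝ) := by gcongr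
      _ = Real.sqrt N := by
        rw [← Real.rpow_add hN0, Real.sqrt_eq_rpow]
        norm_num
  have hQ : (2 * Real.exp N₂ ^ 6) ^ M ≤ Real.exp (7 * A) := by
    have h2 : (2 : ℝ) ≤ Real.exp 1 := by
      have := Real.add_one_le_exp (1 : ℝ)
      linarith
    calc (2 * Real.exp N₂ ^ 6) ^ M ≤ (Real.exp 1 * Real.exp N₂ ^ 6) ^ M := by gcongr
      _ = Real.exp (M + 6 * (M * N₂)) := by
        rw [← Real.exp_nat_mul, ← Real.exp_add, ← Real.exp_nat_mul]
        congr 1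
        push_cast
        ring
      _ ≤ _ := by
        apply Real.exp_le_exp.2
        linarith
  have hR : Real.exp (-(2 * A)) ≤ ((Real.exp N₂ ^ 2) ^ M)⁻¹ := by
    rw [← pow_mul, ← Real.exp_nat_mul, ← Real.exp_neg]
    apply Real.exp_le_exp.2
    push_cast
    nlinarith
  have h4 : ((1 : ℝ) / 4) ^ (n + 1) ≤ Real.exp (-(10 * A)) * (1 / 4) := by
    rw [pow_succ]
    gcongr
    have h3 : (1 : ℝ) / 4 ≤ Real.exp (-1) := by
      rw [Real.exp_neg, one_div]
      apply inv_anti₀ (Real.exp_pos _)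
      have := Real.exp_one_lt_d9
      linarith
    calc ((1 : ℝ) / 4) ^ n ≤ Real.exp (-1) ^ n := by gcongr
      _ = Real.exp (-n) := by
        rw [← Real.exp_nat_mul]
        congr 1
        ring
      _ ≤ _ := by
        apply Real.exp_le_exp.2
        linarith
  have hfirst : (2 * Real.exp N₂ ^ 6) ^ M * (1 / 4) ^ (n + 1) ≤ Real.exp (-(2 * A)) * (1 / 4) := by
    calc (2 * Real.exp N₂ ^ 6) ^ M * (1 / 4) ^ (n + 1)
        ≤ Real.exp (7 * A) * (Real.exp (-(10 * A)) * (1 / 4)) := by gcongr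
      _ = Real.exp (-(3 * A)) * (1 / 4) := by
        rw [← mul_assoc, ← Real.exp_add]
        congr 2
        ring
      _ ≤ _ := by
        gcongr
        linarith
  have hn3 : (n : ℝ) + 1 ≤ Real.exp (11 * A) := by
    have := Real.add_one_le_exp (11 * A)
    linarith
  have hpown : (36 * δ / Real.exp (-P)) ^ n ≤ Real.exp (11 * A * P) := by
    calc (36 * δ / Real.exp (-P)) ^ n ≤ (1 / Real.exp (-P)) ^ n := by gcongr
      _ = Real.exp (n * P) := by
        rw [Real.exp_neg, one_div, inv_inv, ← Real.exp_nat_mul]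
      _ ≤ _ := by
        apply Real.exp_le_exp.2
        gcongr
  have hsecond : 2 * ((n + 1) * ((2 * Real.exp N₂ ^ 10 * (2 * Real.exp N₂ ^ 6) ^ M /
      Real.exp (Real.sqrt N)) * (36 * δ / Real.exp (-P)) ^ n)) ≤
      Real.exp (-(2 * A)) * (1 / 4) := by
    have h16 : (16 : ℝ) ≤ Real.exp 4 := by
      have h2 : (2 : ℝ) ≤ Real.exp 1 := by
        have := Real.add_one_le_exp (1 : ℝ)
        linarith
      calc (16 : ℝ) = 2 ^ 4 := by norm_num
        _ ≤ Real.exp 1 ^ 4 := by gcongr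
        _ = Real.exp 4 := by rw [← Real.exp_nat_mul]; norm_num
    have hq10 : Real.exp N₂ ^ 10 ≤ Real.exp (10 * A) := by
      rw [← Real.exp_nat_mul]
      apply Real.exp_le_exp.2
      push_cast
      linarith
    calc 2 * ((n + 1) * ((2 * Real.exp N₂ ^ 10 * (2 * Real.exp N₂ ^ 6) ^ M /
          Real.exp (Real.sqrt N)) * (36 * δ / Real.exp (-P)) ^ n))
        ≤ 2 * (Real.exp (11 * A) * ((2 * Real.exp (10 * A) * Real.exp (7 * A) /
          Real.exp (Real.sqrt N)) * Real.exp (11 * A * P))) := by gcongr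
      _ = 16 * (Real.exp (11 * A) * ((Real.exp (10 * A) * Real.exp (7 * A) *
          Real.exp (-Real.sqrt N)) * Real.exp (11 * A * P))) * (1 / 4) := by
        rw [Real.exp_neg]
        ring
      _ ≤ Real.exp 4 * (Real.exp (11 * A) * ((Real.exp (10 * A) * Real.exp (7 * A) *
          Real.exp (-Real.sqrt N)) * Real.exp (11 * A * P))) * (1 / 4) := by gcongr
      _ = Real.exp (4 + 28 * A + 11 * A * P - Real.sqrt N) * (1 / 4) := by
        simp only [← Real.exp_add]
        congr 2
        ring
      _ ≤ _ := by
        gcongr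
        nlinarith
  have := Real.exp_pos (-(2 * A))
  linarith

/-- The center of a good elementary region provides the rows of its Green's function. -/
theorem exists_green_row_of_elementary {d : ℕ} {b : Fin d → ℕ}
    {S : Matrix (Fin d → ℤ) (Fin d → ℤ) ℂ} {v : Torus b → ℝ} {lam ρ ρbar N E : ℝ}
    (hS : IsHopping ρ S) (hlam : 1 < lam) (hN : 0 ≤ N) {ω : Vec b} {x : Torus b}
    {Λ W : Finset (Fin d → ℤ)}
    (hgood : ∀ c ∈ Λ, IsGood S v lam ω ρbar N E (shift x ω c)) (hW : IsElementary N W)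
    (hWΛ : W ⊆ Λ) {k : Fin d → ℤ} (hk : k ∈ W) :
    ∃ g : (Fin d → ℤ) → ℂ, (∀ n, ‖g n‖ ≤ Real.exp (Real.sqrt N)) ∧
      (∀ n, N / 10 ≤ ‖k - n‖ → ‖g n‖ ≤ Real.exp (-ρbar * ‖k - n‖)) ∧
      ∀ n' ∈ W, ∑ n ∈ W,
        g n * opEntry S lam E (fun n => (v (shift x ω n) : ℂ)) n n' = if k = n' then 1 else 0 := by
  obtain ⟨c, Q, hQ, rfl⟩ := hW
  refine exists_green_row hS hlam (hgood c (hWΛ ?_)) hQ hk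
  rw [mem_image_add, sub_self]
  exact hQ.zero_mem hN

/-- This puts the translates in the form of the sections in property P: for each site, the phases of
the other blocks are fixed and the block `j` is translated. -/
theorem shift_toTorus_update {d : ℕ} {b : Fin d → ℕ} (x ω : Vec b) (j : Fin d)
    (y : Fin (b j) → ℝ) (n : Fin d → ℤ) :
    shift (toTorus (Function.update x j y)) ω n =
      Function.update (shift (toTorus x) ω n) j
        ((fun l => (y l : UnitAddCircle)) + fun l => (((n j : ℝ) * ω j l : ℝ) : UnitAddCircle)) := by
  funext i
  by_cases hi : i = j
  · subst hi
    rw [Function.update_self]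
    funext l
    simp [shift, toTorus]
  · rw [Function.update_of_ne hi]
    funext l
    simp [shift, toTorus, hi]

theorem volume_greenNorm_large_le_of_admissible {d : ℕ} {b : Fin d → ℕ}
    {S : Matrix (Fin d → ℤ) (Fin d → ℤ) ℂ} {v : Torus b → ℝ} (hv : IsAnalyticOnTorus v)
    {lam ρ ρ₀ ρbar E C r γ N₁ N₂ N L : ℝ} (hr : 0 < r) (hC : 1 ≤ C)
    (hext : ∀ p θ : Vec b, ‖θ‖ ≤ 1 → ExtendsAlong (fun x => v (toTorus x)) r C p θ)
    (hS : IsHopping ρ S) (hρ : 0 < ρ) (hlam : 1 < lam) (hρ₀ : 0 < ρ₀) (hρbar : ρ₀ ≤ ρbar)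
    {j : Fin d} (hj : 1 ≤ b j) (hd : 1 ≤ d) (hadm : AdmissibleScales d (b j) ρ ρ₀ r C N₁ N₂ N L)
    (hγ : N₂ ^ γ = N₁ ^ 2)
    {Ω₁ Ω₂ : Set (Vec b)} {X₁ X₂ : Vec b → ℝ → Set (Torus b)}
    (hP₁ : HasPropertyP S v lam γ ρbar N₁ Ω₁ X₁) (hP₂ : HasPropertyP S v lam γ ρbar N₂ Ω₂ X₂)
    {ω x : Vec b} (hω : ω ∈ Ω₂ ∩ Ω₁) {V Λ : Finset (Fin d → ℤ)} (hV : V ⊆ Λ)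
    (hΛ : IsElementary N Λ)
    (hdiam : Metric.diam (V : Set (Fin d → ℤ)) ≤ 10 * N ^ (1 / (10 * (d : ℝ))))
    (hcov : ∀ k ∈ Λ \ V,
      (∃ W : Finset (Fin d → ℤ), IsElementary N₁ W ∧ k ∈ W ∧ W ⊆ Λ \ V ∧
        ∀ m ∈ (Λ \ V) \ W, N₁ / 2 ≤ ‖k - m‖) ∧ shift (toTorus x) ω k ∉ X₁ ω E) :
    volume {y : Fin (b j) → ℝ | ‖y - x j‖ ≤ Real.exp (-ρ * N₁) ∧
        ENNReal.ofReal (Real.exp (Real.sqrt N)) ≤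
          greenNorm S v lam ω Λ E (toTorus (Function.update x j y))} ≤
      ENNReal.ofReal (Real.exp (-N ^ (1 / (3 * (b j : ℝ))))) := by
  have hN₁ := hadm.one_le
  have hN₂ : 1 ≤ N₂ := hN₁.trans hadm.le_mid
  have hN : 1 ≤ N := by linarith [hadm.two_mul_le]
  have hN0 : 0 < N := by linarith
  set δ := Real.exp (-ρ * N₁) with hδ
  have hδ0 : 0 < δ := Real.exp_pos _
  have hδ1 := hadm.radius_le_one
  have hδr := hadm.radius_le
  have hcardL : (Λ.card : ℝ) ≤ L := (hΛ.card_le hN0.le).trans hadm.card_le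
  have hL1 : 1 ≤ L := (one_le_pow₀ (by linarith)).trans hadm.card_le
  have huC : ∀ (y : Vec b) (m : Fin d → ℤ), ‖((v (shift (toTorus y) ω m) : ℝ) : ℂ)‖ ≤ C := by
    intro y m
    rw [Complex.norm_real, Real.norm_eq_abs, shift_toTorus]
    exact (hext _ 0 (by simp)).abs_le hr
  -- For large `|E|` a Neumann series leaves no bad phases. In the remaining case `|E|` is bounded
  -- in terms of `L` and `C`, which makes the estimates uniform in `E`.
  rcases le_or_gt (2 * (L * (1 + C)) + 1) |E| with hE | hE
  · have hempty : {y : Fin (b j) → ℝ | ‖y - x j‖ ≤ δ ∧ ENNReal.ofReal (Real.exp (Real.sqrt N)) ≤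
          greenNorm S v lam ω Λ E (toTorus (Function.update x j y))} = ∅ := by
      rw [Set.eq_empty_iff_forall_notMem]
      rintro y ⟨_, hy⟩
      have hunit := isUnit_of_large_energy hS hρ hlam (by linarith)
        (huC (Function.update x j y)) hcardL hE
      rw [← boxOperator_eq_opMatrix hlam] at hunit
      rw [greenNorm, if_pos hunit.1, ENNReal.ofReal_le_ofReal_iff (norm_nonneg _)] at hy
      have h1 := toEuclideanCLM_norm_le (G := green S v lam ω Λ E (toTorus (Function.update x j y)))
        (g := 2) (by norm_num) (fun i l =>
          (Finset.single_le_sum (f := fun l => ‖_‖) (fun _ _ => norm_nonneg _)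
            (Finset.mem_univ l)).trans (hunit.2 i))
      rw [Fintype.card_coe] at h1
      have h2 : (Λ.card : ℝ) ^ 2 * 2 ≤ 2 * L ^ 2 := by
        rw [mul_comm]
        gcongr
      linarith [hadm.energy_lt]
    rw [hempty, measure_empty]
    exact zero_le
  -- control at the center
  have hcenter : IsUnit (boxOperator S v lam ω (Λ \ V) E (toTorus x)) ∧
      ∀ i, ∑ l, ‖(boxOperator S v lam ω (Λ \ V) E (toTorus x))⁻¹ i l‖ ≤
        2 * (L * Real.exp (Real.sqrt N₁)) := by
    rw [boxOperator_eq_opMatrix hlam]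
    refine isUnit_of_cover hS hρ hlam (by linarith) hρ₀ hρbar ?_ hadm.cover_small (fun k hk => ?_)
    · exact le_trans (by exact_mod_cast Finset.card_le_card Finset.sdiff_subset) hcardL
    · obtain ⟨⟨W, hW, hkW, hWΛ, hdist⟩, _⟩ := hcov k hk
      exact ⟨W, hWΛ, hkW, hdist, exists_green_row_of_elementary hS hlam (by linarith)
        (fun c hc => hP₁.good ω hω.2 E _ (hcov c hc).2) hW hWΛ hkW⟩
  -- control of the whole region at some phase
  obtain ⟨y₀, hy₀, hy₀X⟩ := exists_mem_closedBall_notMem (x := x j) hδ0 (by linarith)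
    (Real.exp_pos (-N₁ ^ 2)).le Λ
    (fun n => {θ : Fin (b j) → UnitAddCircle |
      Function.update (shift (toTorus x) ω n) j θ ∈ X₂ ω E})
    (fun n l => (((n j : ℝ) * ω j l : ℝ) : UnitAddCircle))
    (fun n _ => by
      have := hP₂.measure_section_le ω hω.1 E j (shift (toTorus x) ω n)
      rwa [hγ] at this)
    (lt_of_le_of_lt (by gcongr) hadm.measure_lt)
  have hfloor : 2 * ⌊N₂⌋ ≤ ⌊N⌋ := by
    rw [Int.le_floor]
    push_cast
    have := Int.floor_le N₂
    linarith [hadm.two_mul_le]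
  have hwhole : IsUnit (boxOperator S v lam ω Λ E (toTorus (Function.update x j y₀))) ∧
      ∀ i, ∑ l, ‖(boxOperator S v lam ω Λ E (toTorus (Function.update x j y₀)))⁻¹ i l‖ ≤
        2 * (L * Real.exp (Real.sqrt N₂)) := by
    rw [boxOperator_eq_opMatrix hlam]
    refine isUnit_of_cover hS hρ hlam (by linarith) hρ₀ hρbar hcardL hadm.cover_mid
      (fun k hk => ?_)
    obtain ⟨W, hW, hkW, hWΛ, hdist⟩ := hΛ.exists_subregion (by linarith) hfloor hk
    refine ⟨W, hWΛ, hkW, hdist, exists_green_row_of_elementary hS hlam (by linarith)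
        (fun c hc => hP₂.good ω hω.1 E _ ?_) hW hWΛ hkW⟩
    rw [shift_toTorus_update]
    exact hy₀X c hc
  have hbase := hadm.base_le
  have hexp1 : 1 ≤ Real.exp (Real.sqrt N₂) := Real.one_le_exp (Real.sqrt_nonneg _)
  have hLe : L ≤ L * Real.exp (Real.sqrt N₂) := le_mul_of_one_le_right (by linarith) hexp1
  have hLe1 : L * Real.exp (Real.sqrt N₁) ≤ L * Real.exp (Real.sqrt N₂) := by
    gcongr
    exact hadm.le_mid
  have hMcard : (V.card : ℝ) ≤ 21 ^ d * N ^ (1 / 10 : ℝ) := by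
    have hs : 1 ≤ N ^ (1 / (10 * (d : ℝ))) := Real.one_le_rpow hN (by positivity)
    calc (V.card : ℝ) ≤ (2 * (10 * N ^ (1 / (10 * (d : ℝ)))) + 1) ^ d :=
          card_le_of_diam (by positivity) hdiam
      _ ≤ (21 * N ^ (1 / (10 * (d : ℝ)))) ^ d := by
          gcongr
          linarith
      _ = 21 ^ d * N ^ (1 / 10 : ℝ) := by
          rw [mul_pow, ← Real.rpow_natCast (N ^ _), ← Real.rpow_mul hN0.le]
          congr 2
          have : (d : ℝ) ≠ 0 := by positivity
          field_simp
  obtain ⟨n, hn, hnum⟩ := cartan_numerics hN₂ hN hδ0 hδ1 hMcard hadm.cartan_le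
  set T := L * Real.exp (Real.sqrt N₂) with hT
  have hCT : C ≤ C * T := le_mul_of_one_le_right (by linarith) (hL1.trans hLe)
  have hLC : L * (1 + C) ≤ T * (1 + C) := by gcongr
  have hbase' : 4 * (C * T) + 5 * T ≤ Real.exp N₂ := by linarith
  -- The single bound `q = e^{N₂}` dominates the entries, the cardinality and both Green's
  -- functions, by `base_le`.
  refine (volume_greenNorm_large_le hv hr hext hS hρ hlam hj hV (q := Real.exp N₂) ?_ ?_ hδ0
    (by linarith) (by linarith) (by positivity) ?_ hadm.perturb hcenter.1 hcenter.2 hy₀ hwhole.1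
    (fun i => (hwhole.2 i).trans ?_) (Real.exp_pos _) (Real.exp_pos _) n hnum).trans ?_
  · linarith
  · linarith
  · linarith
  · linarith
  · rw [← ENNReal.ofReal_natCast (b j), ← ENNReal.ofReal_ofNat 2, ← ENNReal.ofReal_pow (by norm_num),
      ← ENNReal.ofReal_mul (by positivity), ← ENNReal.ofReal_mul (by positivity)]
    apply ENNReal.ofReal_le_ofReal
    -- The exponent `1/3` is reached for every block size and is weakened to the required one only
    -- here.
    have h3 : Real.exp (-N ^ (1 / 3 : ℝ)) ≤ Real.exp (-N ^ (1 / (3 * (b j : ℝ)))) := by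
      apply Real.exp_le_exp.2
      have hbj : (1 : ℝ) ≤ b j := by exact_mod_cast hj
      have : 1 / (3 * (b j : ℝ)) ≤ 1 / 3 :=
        one_div_le_one_div_of_le (by norm_num) (by linarith)
      have := Real.rpow_le_rpow_of_exponent_le hN this
      linarith
    refine le_trans ?_ h3
    have hsplit : N ^ (3 / 8 : ℝ) = N ^ (1 / 3 : ℝ) * N ^ (1 / 24 : ℝ) := by
      rw [← Real.rpow_add hN0]
      norm_num
    have hsplit' : N ^ (1 / 3 : ℝ) = N ^ (1 / 8 : ℝ) * N ^ (5 / 24 : ℝ) := by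
      rw [← Real.rpow_add hN0]
      norm_num
    have hpos3 : 0 < N ^ (1 / 3 : ℝ) := by positivity
    have h4 : N ^ (1 / 3 : ℝ) ≤ Real.exp (N ^ (3 / 8 : ℝ) - N ^ (1 / 3 : ℝ)) := by
      have := Real.add_one_le_exp (N ^ (3 / 8 : ℝ) - N ^ (1 / 3 : ℝ))
      have h6 := mul_le_mul_of_nonneg_left hadm.two_le hpos3.le
      linarith
    have h5 : (b j : ℝ) * 2 ^ b j * (2 * n) ≤ N ^ (1 / 3 : ℝ) := by
      calc (b j : ℝ) * 2 ^ b j * (2 * n) = n * (2 * (b j * 2 ^ b j)) := by ring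
        _ ≤ N ^ (1 / 8 : ℝ) * N ^ (5 / 24 : ℝ) := by
          gcongr
          exact hadm.dim_le
        _ = _ := hsplit'.symm
    calc (b j : ℝ) * 2 ^ b j * (2 * n * Real.exp (-N ^ (3 / 8 : ℝ)))
        = ((b j : ℝ) * 2 ^ b j * (2 * n)) * Real.exp (-N ^ (3 / 8 : ℝ)) := by ring
      _ ≤ Real.exp (N ^ (3 / 8 : ℝ) - N ^ (1 / 3 : ℝ)) * Real.exp (-N ^ (3 / 8 : ℝ)) := by
          gcongr
          exact h5.trans h4
      _ = Real.exp (-N ^ (1 / 3 : ℝ)) := by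
          rw [← Real.exp_add]
          congr 1
          ring

/-! ### Admissibility of large scales -/

open Filter Topology in
theorem eventually_rpow_add_sqrt_le {c : ℝ} (hc : c < 1) (a a' K : ℝ) {κ : ℝ} (hκ : 0 < κ) :
    ∀ᶠ X : ℝ in atTop, a * X ^ c + a' * Real.sqrt X + K ≤ κ * X := by
  have h1 : Tendsto (fun X : ℝ => X ^ (-(1 - c))) atTop (𝓝 0) :=
    tendsto_rpow_neg_atTop (by linarith)
  have h2 : Tendsto (fun X : ℝ => X ^ (-(1 / 2 : ℝ))) atTop (𝓝 0) :=
    tendsto_rpow_neg_atTop (by norm_num)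
  have h3 : Tendsto (fun X : ℝ => X ^ (-(1 : ℝ))) atTop (𝓝 0) :=
    tendsto_rpow_neg_atTop (by norm_num)
  have h := ((h1.const_mul a).add (h2.const_mul a')).add (h3.const_mul K)
  simp only [mul_zero, add_zero] at h
  filter_upwards [h.eventually_le_const hκ, eventually_gt_atTop 0] with X hX hX0
  have e1 : X ^ c = X ^ (-(1 - c)) * X := by
    rw [← Real.rpow_add_one hX0.ne']
    congr 1
    ring
  have e2 : Real.sqrt X = X ^ (-(1 / 2 : ℝ)) * X := by
    rw [← Real.rpow_add_one hX0.ne', Real.sqrt_eq_rpow]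
    norm_num
  have e3 : K = K * X ^ (-(1 : ℝ)) * X := by
    rw [Real.rpow_neg_one]
    field_simp
  calc a * X ^ c + a' * Real.sqrt X + K
      = (a * X ^ (-(1 - c)) + a' * X ^ (-(1 / 2 : ℝ)) + K * X ^ (-(1 : ℝ))) * X := by
        rw [e1, e2]
        nth_rewrite 1 [e3]
        ring
    _ ≤ κ * X := by gcongr

-- The right-hand base is the lower bound for `N` in terms of `X = N₂`. Any power of `N₂` is thus
-- negligible against any positive power of `N`.
open Filter Topology Asymptotics in
theorem eventually_mul_rpow_le_exp {c₂ c₃ s : ℝ} (hc₂ : 0 < c₂) (hc₃ : 0 < c₃) (hs : 0 < s)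
    (K k : ℝ) : ∀ᶠ X : ℝ in atTop, K * X ^ k ≤ (1 / 4 * Real.exp (c₃ * X ^ c₂)) ^ s := by
  have h1 := (isLittleO_rpow_exp_pos_mul_atTop (k / c₂) (mul_pos hs hc₃)).comp_tendsto
    (tendsto_rpow_atTop hc₂)
  have hε : 0 < (1 / 4 : ℝ) ^ s / (|K| + 1) := by positivity
  filter_upwards [h1.def hε, eventually_gt_atTop 0] with X hX hX0
  simp only [Function.comp_apply, Real.norm_eq_abs, Real.abs_exp] at hX
  rw [← Real.rpow_mul hX0.le, mul_div_cancel₀ _ hc₂.ne', abs_of_pos (by positivity),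
    div_mul_eq_mul_div, le_div_iff₀ (by positivity)] at hX
  rw [Real.mul_rpow (by norm_num) (Real.exp_pos _).le, ← Real.exp_mul]
  have e : c₃ * X ^ c₂ * s = s * c₃ * X ^ c₂ := by ring
  rw [e]
  refine le_trans ?_ hX
  have hpos : 0 ≤ X ^ k := by positivity
  nlinarith [le_abs_self K]

theorem exp_neg_two_le : Real.exp (-2) ≤ 1 / 4 := by
  have h2 : (2 : ℝ) ≤ Real.exp 1 := by
    have := Real.add_one_le_exp (1 : ℝ)
    linarith
  have h4 : (4 : ℝ) ≤ Real.exp 2 := by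
    calc (4 : ℝ) = 2 ^ 2 := by norm_num
      _ ≤ Real.exp 1 ^ 2 := by gcongr
      _ = Real.exp 2 := by rw [← Real.exp_nat_mul]; norm_num
  rw [Real.exp_neg, one_div]
  exact inv_anti₀ (by norm_num) h4

/-- The constant `4d + 2` consists of `4d` from `L² = e^{2d(u+2)}` and of `2`, which makes each
exponential at most `e^{-2} ≤ 1/4`. -/
theorem exp_sq_mul_add_le {d : ℕ} {ρ ρ₀ u X : ℝ}
    (h1 : 2 * d * u + 0 * Real.sqrt X + (4 * d + 2) ≤ ρ₀ / 10 * X)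
    (h2 : 2 * d * u + 1 * Real.sqrt X + (4 * d + 2) ≤ 2 * ρ / 5 * X) :
    Real.exp (d * (u + 2)) ^ 2 *
      (Real.exp (-ρ₀ * X / 10) + Real.exp (Real.sqrt X - 2 * ρ * X / 5)) ≤ 1 / 2 := by
  rw [mul_add, ← Real.exp_nat_mul, ← Real.exp_add, ← Real.exp_add]
  have e1 : Real.exp ((2 : ℕ) * (d * (u + 2)) + -ρ₀ * X / 10) ≤ Real.exp (-2) := by
    apply Real.exp_le_exp.2
    push_cast
    linarith
  have e2 : Real.exp ((2 : ℕ) * (d * (u + 2)) + (Real.sqrt X - 2 * ρ * X / 5)) ≤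
      Real.exp (-2) := by
    apply Real.exp_le_exp.2
    push_cast
    linarith
  linarith [exp_neg_two_le]

open Filter Topology in
/-- All sufficiently large scales are admissible. -/
theorem exists_admissibleScales {d : ℕ} (b : Fin d → ℕ) {c₁ c₂ c₃ c₄ ρ ρ₀ r C : ℝ}
    (hc₁ : 0 < c₁) (hc₁' : c₁ < 1) (hc₂ : c₂ = c₁ ^ 2 / 2) (hc₃ : 0 < c₃) (hc₄ : c₄ < 1)
    (hρ : 0 < ρ) (hρ₀ : 0 < ρ₀) (hr : 0 < r) (hC : 1 ≤ C) :
    ∃ Nstar : ℝ, 1 ≤ Nstar ∧ ∀ N₁ N₂ N₃ : ℝ, Nstar ≤ N₁ → N₂ = N₁ ^ (2 / c₁) →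
      N₃ = Real.exp (N₂ ^ c₂) → N₂ ^ c₁ = N₁ ^ 2 ∧
      ∀ N ∈ Set.Icc (1 / 4 * N₃ ^ c₃) (N₃ ^ c₄), ∀ j, ∃ L,
        AdmissibleScales d (b j) ρ ρ₀ r C N₁ N₂ N L := by
  have hc₂0 : 0 < c₂ := by rw [hc₂]; positivity
  have hc₂1 : c₂ < 1 := by nlinarith
  have hX : Tendsto (fun N₁ : ℝ => N₁ ^ (2 / c₁)) atTop atTop :=
    tendsto_rpow_atTop (by positivity)
  have hsmall : Tendsto (fun X : ℝ => 36 * Real.exp (-ρ * X)) atTop (𝓝 0) := by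
    have h1 : Tendsto (fun X : ℝ => -ρ * X) atTop atBot :=
      tendsto_id.const_mul_atTop_of_neg (by linarith)
    simpa using (Real.tendsto_exp_atBot.comp h1).const_mul 36
  -- Vacuous terms such as `0 * √N₁`, and `X^0` below, put all conditions into the shape of the two
  -- asymptotic lemmas.
  have hev : ∀ᶠ N₁ : ℝ in atTop, 1 ≤ N₁ ∧
      (2 * d * N₁ ^ c₁ + 0 * Real.sqrt N₁ + (4 * d + 2) ≤ ρ₀ / 10 * N₁) ∧
      (2 * d * N₁ ^ c₁ + 1 * Real.sqrt N₁ + (4 * d + 2) ≤ 2 * ρ / 5 * N₁) ∧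
      (d * N₁ ^ c₁ + 1 * Real.sqrt N₁ + (2 * d + Real.log (84 * C)) ≤ ρ * N₁) ∧
      36 * Real.exp (-ρ * N₁) ≤ 1 ∧ 36 * Real.exp (-ρ * N₁) ≤ r ∧
      (∀ j, 3 * d + ρ * b j < N₁) :=
    (eventually_ge_atTop 1).and <|
    (eventually_rpow_add_sqrt_le hc₁' _ _ _ (by positivity)).and <|
    (eventually_rpow_add_sqrt_le hc₁' _ _ _ (by positivity)).and <|
    (eventually_rpow_add_sqrt_le hc₁' _ _ _ (by positivity)).and <|
    (hsmall.eventually_le_const one_pos).and <|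
    (hsmall.eventually_le_const hr).and <|
    eventually_all.2 fun j => eventually_gt_atTop _
  have hev₂ : ∀ᶠ X : ℝ in atTop,
      (2 * d * X ^ c₂ + 0 * Real.sqrt X + (4 * d + 2) ≤ ρ₀ / 10 * X) ∧
      (2 * d * X ^ c₂ + 1 * Real.sqrt X + (4 * d + 2) ≤ 2 * ρ / 5 * X) ∧
      (d * X ^ c₂ + 1 * Real.sqrt X + (2 * d + Real.log (4 * C + 5)) ≤ 1 * X) ∧
      (2 * X ^ (1 : ℝ) ≤ (1 / 4 * Real.exp (c₃ * X ^ c₂)) ^ (1 : ℝ)) ∧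
      ((6 * d + 2) * X ^ (1 : ℝ) ≤ (1 / 4 * Real.exp (c₃ * X ^ c₂)) ^ (1 / 2 : ℝ)) ∧
      (45 * (21 ^ d + 1) * X ^ (1 : ℝ) ≤ (1 / 4 * Real.exp (c₃ * X ^ c₂)) ^ (1 / 40 : ℝ)) ∧
      (2 * X ^ (0 : ℝ) ≤ (1 / 4 * Real.exp (c₃ * X ^ c₂)) ^ (1 / 24 : ℝ)) ∧
      ∀ j, 2 * (b j * 2 ^ b j) * X ^ (0 : ℝ) ≤
        (1 / 4 * Real.exp (c₃ * X ^ c₂)) ^ (5 / 24 : ℝ) :=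
    (eventually_rpow_add_sqrt_le hc₂1 _ _ _ (by positivity)).and <|
    (eventually_rpow_add_sqrt_le hc₂1 _ _ _ (by positivity)).and <|
    (eventually_rpow_add_sqrt_le hc₂1 _ _ _ (by positivity)).and <|
    (eventually_mul_rpow_le_exp hc₂0 hc₃ (by norm_num) _ _).and <|
    (eventually_mul_rpow_le_exp hc₂0 hc₃ (by norm_num) _ _).and <|
    (eventually_mul_rpow_le_exp hc₂0 hc₃ (by norm_num) _ _).and <|
    (eventually_mul_rpow_le_exp hc₂0 hc₃ (by norm_num) _ _).and <|
    eventually_all.2 fun j => eventually_mul_rpow_le_exp hc₂0 hc₃ (by norm_num) _ _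
  obtain ⟨A, hA⟩ := eventually_atTop.1 (hev.and (hX.eventually hev₂))
  refine ⟨max 1 A, le_max_left _ _, fun N₁ N₂ N₃ hN₁ hN₂ hN₃ => ?_⟩
  obtain ⟨⟨h1, hcov, hcov', hpert, hrad, hrad', hdim⟩, hmid⟩ := hA N₁ ((le_max_right _ _).trans hN₁)
  rw [← hN₂] at hmid
  obtain ⟨hcov₂, hcov₂', hbase, htwo, hen, hcart, htw, hJ⟩ := hmid
  have hN₁0 : 0 < N₁ := by linarith
  have hγ : N₂ ^ c₁ = N₁ ^ 2 := by
    rw [hN₂, ← Real.rpow_mul hN₁0.le, div_mul_cancel₀ _ hc₁.ne', Real.rpow_two]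
  -- The choice `c₂ = c₁²/2` is made for this identity: `log N₃` is a power of `N₁` below the first,
  -- while being a power of `N₂`.
  have hu : N₂ ^ c₂ = N₁ ^ c₁ := by
    rw [hN₂, ← Real.rpow_mul hN₁0.le, hc₂]
    congr 1
    field_simp
  set u := N₁ ^ c₁ with hudef
  have hu0 : 0 ≤ u := by positivity
  have huN₁ : u ≤ N₁ := by
    have := Real.rpow_le_rpow_of_exponent_le h1 hc₁'.le
    rwa [Real.rpow_one] at this
  have hN₁₂ : N₁ ≤ N₂ := by
    have h2 : (1 : ℝ) ≤ 2 / c₁ := by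
      rw [le_div_iff₀ hc₁]
      linarith
    have := Real.rpow_le_rpow_of_exponent_le h1 h2
    rwa [Real.rpow_one, ← hN₂] at this
  -- With `N ≤ e^u`, one has `2N + 1 ≤ 3N ≤ e^{u+2}`, which explains `L`.
  refine ⟨hγ, fun N hN j => ⟨Real.exp (d * (u + 2)), ?_⟩⟩
  rw [hu] at hcov₂ hcov₂' hbase htwo hen hcart htw hJ hN₃
  rw [hN₃, ← Real.exp_mul, ← Real.exp_mul] at hN
  obtain ⟨hNl, hNu⟩ := hN
  rw [mul_comm u c₃] at hNl
  have hlow : ∀ {s : ℝ}, 0 < s → (1 / 4 * Real.exp (c₃ * u)) ^ s ≤ N ^ s := fun hs =>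
    Real.rpow_le_rpow (by positivity) hNl hs.le
  have hNN₂ : 2 * N₂ ≤ N := by
    have := htwo.trans (hlow one_pos)
    rwa [Real.rpow_one, Real.rpow_one] at this
  have hN1 : 1 ≤ N := by linarith
  refine ⟨h1, hN₁₂, hNN₂, ?_, exp_sq_mul_add_le hcov hcov', exp_sq_mul_add_le hcov₂ hcov₂', ?_,
    hrad, hrad', ?_, ?_, ?_, ?_, ?_, ?_⟩
  · rw [Real.exp_nat_mul]
    gcongr
    have h2 : N ≤ Real.exp u := by
      refine hNu.trans (Real.exp_le_exp.2 ?_)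
      nlinarith
    have h3 : (3 : ℝ) ≤ Real.exp 2 := by
      have := Real.add_one_le_exp (2 : ℝ)
      linarith
    rw [Real.exp_add]
    have := Real.exp_pos u
    nlinarith
  · have hC0 : 0 < 84 * C := by linarith
    have h2 : 84 * C * Real.exp (d * (u + 2) + Real.sqrt N₁ - ρ * N₁) ≤ 1 := by
      rw [← Real.exp_log hC0, ← Real.exp_add, Real.exp_le_one_iff]
      linarith
    have h3 : Real.exp (d * (u + 2) + Real.sqrt N₁ - ρ * N₁) =
        Real.exp (d * (u + 2)) * Real.exp (Real.sqrt N₁) * Real.exp (-ρ * N₁) := by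
      rw [← Real.exp_add, ← Real.exp_add]
      congr 1
      ring
    rw [h3] at h2
    linarith
  · calc Real.exp (d * (u + 2)) * Real.exp (-N₁ ^ 2)
        = Real.exp (d * (u + 2) - N₁ ^ 2) := by
          rw [← Real.exp_add]
          rfl
      _ < Real.exp (b j * (-ρ * N₁)) := by
          apply Real.exp_lt_exp.2
          have h2 := mul_lt_mul_of_pos_right (hdim j) hN₁0
          have h3 : (d : ℝ) * u ≤ d * N₁ := by gcongr
          have h4 : (d : ℝ) * 1 ≤ d * N₁ := by gcongr
          linarith
      _ = Real.exp (-ρ * N₁) ^ b j := by rw [Real.exp_nat_mul]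
      _ ≤ _ := by
          gcongr
          linarith [Real.exp_pos (-ρ * N₁)]
  · have hC0 : 0 < 4 * C + 5 := by linarith
    rw [← Real.exp_add]
    calc (4 * C + 5) * Real.exp (d * (u + 2) + Real.sqrt N₂)
        = Real.exp (Real.log (4 * C + 5) + (d * (u + 2) + Real.sqrt N₂)) := by
          rw [Real.exp_add (Real.log _), Real.exp_log hC0]
      _ ≤ _ := by
          apply Real.exp_le_exp.2
          linarith
  · have h2 := hen.trans (hlow (by norm_num))
    rw [Real.rpow_one, ← Real.sqrt_eq_rpow] at h2
    have h3 : (2 : ℝ) ≤ Real.exp 1 := by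
      have := Real.add_one_le_exp (1 : ℝ)
      linarith
    calc 2 * Real.exp (d * (u + 2)) ^ 2 ≤ Real.exp 1 * Real.exp (d * (u + 2)) ^ 2 := by gcongr
      _ = Real.exp (1 + 2 * (d * (u + 2))) := by
        rw [← Real.exp_nat_mul, ← Real.exp_add]
        norm_num
      _ < Real.exp (Real.sqrt N) := by
        apply Real.exp_lt_exp.2
        have h4 : (d : ℝ) * u ≤ d * N₂ := by
          gcongr
          linarith
        have h5 : (d : ℝ) * 1 ≤ d * N₂ := by
          gcongr
          linarith
        linarith
  · have := hcart.trans (hlow (by norm_num))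
    rw [Real.rpow_one] at this
    linarith
  · have := htw.trans (hlow (by norm_num))
    rwa [Real.rpow_zero, mul_one] at this
  · have := (hJ j).trans (hlow (by norm_num))
    rwa [Real.rpow_zero, mul_one] at this

end QPGreen

theorem theorem3p3 (d : ℕ) (hd : 1 ≤ d) (b : Fin d → ℕ) (hb : ∀ i, 1 ≤ b i)
    (c₁ c₂ c₃ c₄ : ℝ) (hc₃ : 0 < c₃) (hc₃₄ : c₃ < c₄) (hc₄ : c₄ < 1)
    (hc₁ : c₁ = c₃ / (4 * ((Finset.univ.sup b : ℕ) : ℝ))) (hc₂ : c₂ = c₁ ^ 2 / 2)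
    (ρ : ℝ) (hρ : 0 < ρ) (ρ₀ : ℝ) (hρ₀ : 0 < ρ₀)
    (v : QPGreen.Torus b → ℝ) (hv : QPGreen.IsAnalyticOnTorus v) :
    ∃ Nstar : ℝ, 1 ≤ Nstar ∧
      ∀ N₁ N₂ N₃ : ℝ, Nstar ≤ N₁ → N₂ = N₁ ^ (2 / c₁) → N₃ = Real.exp (N₂ ^ c₂) →
      ∀ S : Matrix (Fin d → ℤ) (Fin d → ℤ) ℂ, QPGreen.IsHopping ρ S →
      ∀ lam : ℝ, 1 < lam →
      ∀ ρbar : ℝ, ρ₀ ≤ ρbar →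
      ∀ (Ω₁ Ω₂ : Set (QPGreen.Vec b)) (X₁ X₂ : QPGreen.Vec b → ℝ → Set (QPGreen.Torus b)),
        QPGreen.HasPropertyP S v lam c₁ ρbar N₁ Ω₁ X₁ →
        QPGreen.HasPropertyP S v lam c₁ ρbar N₂ Ω₂ X₂ →
      ∀ ω ∈ Ω₂ ∩ Ω₁, ∀ E : ℝ, ∀ x : QPGreen.Vec b,
      ∀ N ∈ Set.Icc (1 / 4 * N₃ ^ c₃) (N₃ ^ c₄),
      ∀ Λbar Λ : Finset (Fin d → ℤ), Λbar ⊆ Λ → QPGreen.IsElementary N Λ →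
        Metric.diam (Λbar : Set (Fin d → ℤ)) ≤ 10 * N ^ (1 / (10 * (d : ℝ))) →
        (∀ k ∈ Λ \ Λbar,
          (∃ W : Finset (Fin d → ℤ), QPGreen.IsElementary N₁ W ∧ k ∈ W ∧ W ⊆ Λ \ Λbar ∧
            ∀ m ∈ (Λ \ Λbar) \ W, N₁ / 2 ≤ ‖k - m‖) ∧
          QPGreen.shift (QPGreen.toTorus x) ω k ∉ X₁ ω E) →
      ∀ j : Fin d,
        MeasureTheory.volume {y : Fin (b j) → ℝ | ‖y - x j‖ ≤ Real.exp (-ρ * N₁) ∧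
            ENNReal.ofReal (Real.exp (Real.sqrt N)) ≤
              QPGreen.greenNorm S v lam ω Λ E (QPGreen.toTorus (Function.update x j y))} ≤
          ENNReal.ofReal (Real.exp (-N ^ (1 / (3 * (b j : ℝ))))) := by
  -- The potential enters the threshold only through `r` and `C`, fixed before the hopping,
  -- coupling, frequency, energy and phase.
  obtain ⟨r, hr, C, hC, hext⟩ := QPGreen.exists_extendsAlong hv
  have hsup : (1 : ℝ) ≤ ((Finset.univ.sup b : ℕ) : ℝ) := by
    have h0 : b ⟨0, hd⟩ ≤ Finset.univ.sup b := Finset.le_sup (Finset.mem_univ _)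
    exact_mod_cast (hb ⟨0, hd⟩).trans h0
  have hc₁0 : 0 < c₁ := by
    rw [hc₁]
    positivity
  have hc₁1 : c₁ < 1 := by
    rw [hc₁, div_lt_one (by positivity)]
    linarith
  obtain ⟨Nstar, hNstar, h⟩ :=
    QPGreen.exists_admissibleScales b hc₁0 hc₁1 hc₂ hc₃ hc₄ hρ hρ₀ hr hC
  refine ⟨Nstar, hNstar, ?_⟩
  intro N₁ N₂ N₃ hN₁ hN₂ hN₃ S hS lam hlam ρbar hρbar Ω₁ Ω₂ X₁ X₂ hP₁ hP₂ ω hω E x N hN Λbar Λ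
    hsub hΛ hdiam hcov j
  obtain ⟨hγ, hadm⟩ := h N₁ N₂ N₃ hN₁ hN₂ hN₃
  obtain ⟨L, hL⟩ := hadm N hN j
  exact QPGreen.volume_greenNorm_large_le_of_admissible hv hr hC hext hS hρ hlam hρ₀ hρbar (hb j) hd
    hL hγ hP₁ hP₂ hω hsub hΛ hdiam hcov
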